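/- All graphs are finite and simple. A set $S$ of vertices of a graph $G$ is an independent dominating set if no two of its vertices are adjacent and every vertex of $G$ lies in $S$ or is adjacent to a vertex of $S$; $\max(G)$ and $\min(G)$ denote the largest and the smallest size of an independent dominating set of $G$. For $m\ge 2$, a graph is $m$-claw-free if it has no induced subgraph isomorphic to $K_{1,m}$. (a) Let $m\ge 2$. There is a polynomial-time algorithm which, given a graph (by its adjacency matrix), returns a set of its vertices such that, whenever the input $G$ is $m$-claw-free, the returned set $S$ is an independent dominating set of $G$ with $|S|\le \max(G)\le \frac m2\,|S|$. There is also a polynomial-time algorithm which in the same way returns, for every $m$-claw-free $G$, an independent dominating set $S$ of $G$ with $\min(G)\le |S|\le \frac{m(m-1)}2\,\min(G)$. (b) Let $d\ge 2$. A $d$-polycube is a finite union $P$ of closed unit cubes centred at points of $\mathbb Z^d$ (its tiles) whose interior is connected. Let $p$ be a chess piece moving along lines, given by a finite set $D\subset\mathbb Z^d\setminus\{0\}$ of steps with $D=-D$: from a tile $x$ it can travel to $x+kv$ for $v\in D$ and $k\ge 1$ whenever $x,x+v,\dots,x+kv$ are all tiles of $P$. (For the rook $D$ consists of the vectors $\pm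 e_i$, for the queen of all non-zero vectors with coordinates in $\{-1,0,1\}$.) The attack directions of $p$ are the pairs $\{v,-v\}$, $v\in D$. The chess graph of $p$ on $P$ has the tiles of $P$ as vertices, two of them being adjacent if $p$ can travel from one to the other. If $p$ has $m-1\ge 1$ attack directions, then every chess graph of $p$ on a $d$-polycube is $m$-claw-free, and there are polynomial-time algorithms which, given a chess graph $G$ of $p$ on a $d$-polycube, return independent dominating sets $S$ and $S'$ of $G$, respectively, with $|S|\le\max(G)\le \frac m2\,|S|$ and $\min(G)\le|S'|\le \frac{m(m-1)}2\,\min(G)$. -/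

import Mathlib

/-!
Independent domination in finite graphs, `m`-claws, polynomial-time algorithms on graphs
(Mathlib's multi-stack Turing machines), polycubes and chess graphs.
-/

namespace ClawFreeDomination

section Graphs

variable {V : Type*}

/-- `S` is an independent dominating set of `G`: no two of its vertices are adjacent, and every
vertex of `G` lies in `S` or is adjacent to a vertex of `S`. -/
def IsIndepDominating (G : SimpleGraph V) (S : Finset V) : Prop :=
  G.IsIndepSet (S : Set V) ∧ ∀ v, v ∈ S ∨ ∃ w ∈ S, G.Adj w v

/-- `max(G)`: the maximal size of an independent dominating set. -/
noncomputable def maxIndepDom (G : SimpleGraph V) : ℕ :=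
  sSup {k | ∃ S : Finset V, IsIndepDominating G S ∧ S.card = k}

/-- `min(G)`: the minimal size of an independent dominating set. -/
noncomputable def minIndepDom (G : SimpleGraph V) : ℕ :=
  sInf {k | ∃ S : Finset V, IsIndepDominating G S ∧ S.card = k}

/-- `G` has no induced subgraph isomorphic to the `m`-claw `K_{1,m}`. -/
def ClawFree (m : ℕ) (G : SimpleGraph V) : Prop :=
  ¬ (completeBipartiteGraph (Fin 1) (Fin m)).IsIndContained G

end Graphs

section Algorithms

/-- The instances: finite simple graphs on the vertices `0, …, n - 1`. -/
abbrev FinGraph : Type := Σ n : ℕ, SimpleGraph (Fin n)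

open Classical in
/-- A graph is written as its adjacency matrix, row after row, with the symbol `none` at the end of
each row. -/
noncomputable def encodeGraph (G : FinGraph) : List (Option Bool) :=
  (List.finRange G.1).flatMap fun i =>
    ((List.finRange G.1).map fun j => some (decide (G.2.Adj i j))) ++ [none]

/-- A set of vertices is written as its characteristic vector. -/
def encodeVertexSet {n : ℕ} (S : Finset (Fin n)) : List Bool :=
  (List.finRange n).map fun i => decide (i ∈ S)

/-- The assignment of a vertex set to every finite graph is computed by a Turing machine in a number
of steps that is polynomial in the length of the encoded graph. -/
def IsPolyTime (A : (G : FinGraph) → Finset (Fin G.1)) : Prop :=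
  Nonempty (Turing.TM2ComputableInPolyTime encodeGraph (id : List Bool → List Bool)
    fun G => encodeVertexSet (A G))

/-- On the graphs of the class `C`, maximal independent domination is approximated in polynomial
time within the factor `r`: a polynomial-time algorithm finds an independent dominating set `S`
with `max(G) ≤ r * |S|` (and `|S| ≤ max(G)`, as for every such set). -/
def MaxApproxInPolyTime (C : FinGraph → Prop) (r : ℝ) : Prop :=
  ∃ A : (G : FinGraph) → Finset (Fin G.1), IsPolyTime A ∧
    ∀ G, C G → IsIndepDominating G.2 (A G) ∧
      (maxIndepDom G.2 : ℝ) ≤ r * ((A G).card : ℝ)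

/-- On the graphs of the class `C`, minimal independent domination is bounded in polynomial time
within the factor `r`: a polynomial-time algorithm finds an independent dominating set `S`
with `|S| ≤ r * min(G)` (and `min(G) ≤ |S|`, as for every such set). -/
def MinBoundInPolyTime (C : FinGraph → Prop) (r : ℝ) : Prop :=
  ∃ A : (G : FinGraph) → Finset (Fin G.1), IsPolyTime A ∧
    ∀ G, C G → IsIndepDominating G.2 (A G) ∧
      ((A G).card : ℝ) ≤ r * (minIndepDom G.2 : ℝ)

end Algorithms

section Chess

variable {d : ℕ}

/-- The closed unit cube of `ℝ^d` centred at the integer point `c`. -/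
def unitCube (c : Fin d → ℤ) : Set (Fin d → ℝ) :=
  {x | ∀ i, |x i - (c i : ℝ)| ≤ 1 / 2}

/-- A finite set of tiles, given by their centres, is a polycube if the interior of the union of the
unit cubes is connected (in particular non-empty). -/
def IsPolycube (P : Finset (Fin d → ℤ)) : Prop :=
  IsConnected (interior (⋃ c ∈ P, unitCube c))

/-- A chess piece that moves along lines: a finite set of non-zero steps, closed under negation.
For the rook these are the `±e_i`, for the queen all non-zero vectors with coordinates in
`{-1, 0, 1}`. -/
structure ChessPiece (d : ℕ) where
  steps : Finset (Fin d → ℤ)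
  zero_notMem : 0 ∉ steps
  neg_mem : ∀ v ∈ steps, -v ∈ steps

/-- The number of attack directions of a piece; opposite steps belong to the same direction. -/
def ChessPiece.numDirections (p : ChessPiece d) : ℕ :=
  (p.steps.image fun v => ({v, -v} : Finset (Fin d → ℤ))).card

/-- The piece `p` attacks from `x` the tile `x + k v`, where `v` is a step and `k ≥ 1`, as long as
all the tiles `x, x + v, …, x + k v` are in `P`. -/
def ChessPiece.Attacks (p : ChessPiece d) (P : Finset (Fin d → ℤ)) (x y : Fin d → ℤ) : Prop :=
  ∃ v ∈ p.steps, ∃ k : ℕ, 1 ≤ k ∧ y = x + k • v ∧ ∀ j ≤ k, x + j • v ∈ P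

theorem ChessPiece.Attacks.symm {p : ChessPiece d} {P : Finset (Fin d → ℤ)} {x y : Fin d → ℤ}
    (h : p.Attacks P x y) : p.Attacks P y x := by
  obtain ⟨v, hv, k, hk, rfl, hP⟩ := h
  refine ⟨-v, p.neg_mem v hv, k, hk, by simp, fun j hj => ?_⟩
  have h := hP (k - j) (Nat.sub_le k j)
  have e : x + k • v + j • -v = x + (k - j) • v := by
    obtain ⟨i, rfl⟩ := Nat.exists_eq_add_of_le hj
    simp [add_smul]
    abel
  rwa [e]

theorem ChessPiece.not_attacks_self (p : ChessPiece d) (P : Finset (Fin d → ℤ)) (x : Fin d → ℤ) :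
    ¬ p.Attacks P x x := by
  rintro ⟨v, hv, k, hk, h, -⟩
  have h0 : k • v = 0 := by simpa using h
  rcases smul_eq_zero.mp h0 with h1 | h1
  · omega
  · exact p.zero_notMem (h1 ▸ hv)

/-- The chess graph of the piece `p` on `P`: its vertices are the tiles of `P`, and two tiles are
adjacent if `p` can travel from one to the other. -/
def chessGraph (p : ChessPiece d) (P : Finset (Fin d → ℤ)) : SimpleGraph {x // x ∈ P} where
  Adj x y := p.Attacks P x y
  symm := ⟨fun _ _ h => h.symm⟩
  loopless := ⟨fun x => p.not_attacks_self P x⟩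

/-- `G` is a chess graph of `p`: it arises from a polycube by enumerating its tiles. -/
def IsChessGraph (p : ChessPiece d) (G : FinGraph) : Prop :=
  ∃ P : Finset (Fin d → ℤ), IsPolycube P ∧ Nonempty (G.2 ≃g chessGraph p P)

end Chess

end ClawFreeDomination

/-! One local search serves all the claims. It starts with the empty set and keeps a set S
independent; it brings in one vertex, or two non-adjacent ones, and removes their neighbours
whenever this enlarges S. As S has at most n vertices, it grows at most n times, so polynomially
many rounds over all pairs reach a set that no exchange enlarges (`locallyOptimal_searchResult`).
Exchanges with a single vertex show that such an S is dominating.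

Maximum: for an independent set T, count the pairs (s, t) in S × T that are equal or adjacent. Each
s lies in at most m - 1 pairs, as otherwise it is the centre of an m-claw. Each t lies in at least
one pair, and at most |S| of them lie in exactly one: two vertices of T with the same sole partner s
could be exchanged for s. Hence 2|T| - |S| ≤ (m - 1)|S| (`LocallyOptimal.two_mul_card_le`).

Minimum: the same count with the roles swapped gives |S| ≤ (m - 1)|T| for every independent
dominating T (`ClawFree.card_le_mul_card`), and m - 1 ≤ m(m - 1)/2 since m ≥ 2.

Chess graphs: among m tiles attacked from x along m - 1 directions, two share a direction. They lie
on one line through x without gaps between them, so they attack each other (`clawFree_chessGraph`).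

Running time: the search is written in a small structured language over stacks, compiled to a stack
machine with one machine step per counted step (`Runs.stepsTo`). Each loop is shown to compute a
fold over a list within an explicit time (`RunsIn.foldl`, `localSearch_runsIn`). -/

namespace ClawFreeDomination

open Turing

/-! ### Structured stack programs and their compilation to stack machines -/

section Language

variable {K : Type} (Γ : K → Type) (σ : Type)

/-- Loop-free code acting on a finite register and on stacks. -/
inductive Blk : Type
  | nil : Blk
  | push (k : K) (f : σ → Γ k) (b : Blk) : Blk
  | pop (k : K) (f : σ → Option (Γ k) → σ) (b : Blk) : Blk
  | load (f : σ → σ) (b : Blk) : Blk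
  | ite (p : σ → Bool) (b₁ b₂ b : Blk) : Blk

/-- Structured programs. `loop b p c` executes `b`, stops if `p` fails, and otherwise executes `c`
and starts again. -/
inductive Cmd : Type
  | block (b : Blk Γ σ) : Cmd
  | seq (c₁ c₂ : Cmd) : Cmd
  | ite (p : σ → Bool) (c₁ c₂ : Cmd) : Cmd
  | loop (b : Blk Γ σ) (p : σ → Bool) (c : Cmd) : Cmd

/-- The contents of the register and of the stacks. -/
abbrev Mem : Type := σ × (∀ k, List (Γ k))

variable {Γ σ}

/-- The labels of the stack machine that executes a program. -/
def Cmd.Pos : Cmd Γ σ → Type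
  | .block _ => Unit
  | .seq c₁ c₂ => c₁.Pos ⊕ c₂.Pos
  | .ite _ c₁ c₂ => Option (c₁.Pos ⊕ c₂.Pos)
  | .loop _ _ c => Option c.Pos

/-- The label at which the execution of a program starts. -/
def Cmd.entry : (c : Cmd Γ σ) → c.Pos
  | .block _ => ()
  | .seq c₁ _ => Sum.inl c₁.entry
  | .ite _ _ _ => none
  | .loop _ _ _ => none

/-- A `FinTM2` needs finitely many labels. -/
theorem Cmd.finite_pos (c : Cmd Γ σ) : Finite c.Pos := by
  induction c with
  | block b => exact inferInstanceAs (Finite Unit)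
  | seq c₁ c₂ h₁ h₂ => exact inferInstanceAs (Finite (c₁.Pos ⊕ c₂.Pos))
  | ite p c₁ c₂ h₁ h₂ => exact inferInstanceAs (Finite (Option (c₁.Pos ⊕ c₂.Pos)))
  | loop b p c h => exact inferInstanceAs (Finite (Option c.Pos))

variable [DecidableEq K]

/-- The effect of loop-free code. -/
def Blk.eval : Blk Γ σ → Mem Γ σ → Mem Γ σ
  | .nil, s => s
  | .push k f b, s => b.eval (s.1, Function.update s.2 k (f s.1 :: s.2 k))
  | .pop k f b, s => b.eval (f s.1 (s.2 k).head?, Function.update s.2 k (s.2 k).tail)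
  | .load f b, s => b.eval (f s.1, s.2)
  | .ite p b₁ b₂ b, s => b.eval (cond (p s.1) (b₁.eval s) (b₂.eval s))

/-- `Runs c s t s'`: started in `s`, the program `c` ends in `s'` after `t` steps. -/
inductive Runs : Cmd Γ σ → Mem Γ σ → ℕ → Mem Γ σ → Prop
  | block (b s) : Runs (.block b) s 1 (b.eval s)
  | seq {c₁ c₂ s s' s'' t t'} : Runs c₁ s t s' → Runs c₂ s' t' s'' →
      Runs (.seq c₁ c₂) s (t + t') s''
  | ite_true {p c₁ c₂ s t s'} : p s.1 = true → Runs c₁ s t s' → Runs (.ite p c₁ c₂) s (1 + t) s'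
  | ite_false {p c₁ c₂ s t s'} : p s.1 = false → Runs c₂ s t s' → Runs (.ite p c₁ c₂) s (1 + t) s'
  | loop_exit {b p c s} : p (b.eval s).1 = false → Runs (.loop b p c) s 1 (b.eval s)
  | loop_step {b p c s t s' t' u} : p (b.eval s).1 = true → Runs c (b.eval s) t s' →
      Runs (.loop b p c) s' t' u → Runs (.loop b p c) s (1 + t + t') u

/-- Loop-free code followed by a statement of a stack machine. -/
def Blk.toStmt {Λ : Type} : Blk Γ σ → TM2.Stmt Γ Λ σ → TM2.Stmt Γ Λ σ
  | .nil, q => q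
  | .push k f b, q => .push k f (b.toStmt q)
  | .pop k f b, q => .pop k f (b.toStmt q)
  | .load f b, q => .load f (b.toStmt q)
  | .ite p b₁ b₂ b, q => .branch p (b₁.toStmt (b.toStmt q)) (b₂.toStmt (b.toStmt q))

/-- A branch copies the remaining code into both arms, so a whole block is a single statement and
costs one machine step. -/
theorem Blk.stepAux_toStmt {Λ : Type} (b : Blk Γ σ) (q : TM2.Stmt Γ Λ σ) (s : Mem Γ σ) :
    TM2.stepAux (b.toStmt q) s.1 s.2 = TM2.stepAux q (b.eval s).1 (b.eval s).2 := by
  induction b generalizing q s with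
  | nil => rfl
  | push k f b ih => exact ih q (s.1, Function.update s.2 k (f s.1 :: s.2 k))
  | pop k f b ih => exact ih q (f s.1 (s.2 k).head?, Function.update s.2 k (s.2 k).tail)
  | load f b ih => exact ih q (f s.1, s.2)
  | ite p b₁ b₂ b ih₁ ih₂ ih =>
    simp only [toStmt, TM2.stepAux, eval]
    cases p s.1 <;> simp [ih, ih₁, ih₂]

/-- The statements of the stack machine that executes a program as part of a larger machine, where
`e` embeds the labels and the execution continues at `x`. -/
def Cmd.compile {Λ : Type} : (c : Cmd Γ σ) → (e : c.Pos → Λ) → (x : Λ) → c.Pos → TM2.Stmt Γ Λ σ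
  | .block b, _, x, _ => b.toStmt (.goto fun _ => x)
  | .seq c₁ c₂, e, _, .inl l => c₁.compile (fun y => e (.inl y)) (e (.inr c₂.entry)) l
  | .seq _ c₂, e, x, .inr l => c₂.compile (fun y => e (.inr y)) x l
  | .ite p c₁ c₂, e, _, none =>
    .branch p (.goto fun _ => e (some (.inl c₁.entry))) (.goto fun _ => e (some (.inr c₂.entry)))
  | .ite _ c₁ _, e, x, some (.inl l) => c₁.compile (fun y => e (some (.inl y))) x l
  | .ite _ _ c₂, e, x, some (.inr l) => c₂.compile (fun y => e (some (.inr y))) x l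
  | .loop b p c, e, x, none =>
    b.toStmt (.branch p (.goto fun _ => e (some c.entry)) (.goto fun _ => x))
  | .loop _ _ c, e, _, some l => c.compile (fun y => e (some y)) (e none) l

/-- The machine `M` passes from `a` to `b` in `t` steps. -/
def StepsTo {Λ : Type} (M : Λ → TM2.Stmt Γ Λ σ) (a : TM2.Cfg Γ Λ σ) (t : ℕ) (b : TM2.Cfg Γ Λ σ) :
    Prop :=
  (flip bind (TM2.step M))^[t] (some a) = some b

theorem StepsTo.trans {Λ : Type} {M : Λ → TM2.Stmt Γ Λ σ} {a b c : TM2.Cfg Γ Λ σ} {t t' : ℕ}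
    (h : StepsTo M a t b) (h' : StepsTo M b t' c) : StepsTo M a (t + t') c := by
  unfold StepsTo at *
  rw [add_comm, Function.iterate_add_apply, h, h']

/-- Induction on the run. The exit label `x` varies because the first half of a sequence and the
body of a loop exit to labels inside the program. -/
theorem Runs.stepsTo {Λ : Type} {M : Λ → TM2.Stmt Γ Λ σ} {c : Cmd Γ σ} {s s' : Mem Γ σ} {t : ℕ}
    (h : Runs c s t s') (e : c.Pos → Λ) (x : Λ) (hM : ∀ l, M (e l) = c.compile e x l) :
    StepsTo M ⟨some (e c.entry), s.1, s.2⟩ t ⟨some x, s'.1, s'.2⟩ := by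
  induction h generalizing x with
  | block b s =>
    have := hM (Cmd.entry (.block b))
    change some _ = some _
    rw [this, Cmd.compile, Blk.stepAux_toStmt]
    rfl
  | @seq c₁ c₂ s s' s'' t t' _ _ ih₁ ih₂ =>
    exact (ih₁ (fun y => e (.inl y)) (e (.inr c₂.entry)) fun l => hM (.inl l)).trans
      (ih₂ (fun y => e (.inr y)) x fun l => hM (.inr l))
  | @ite_true p c₁ c₂ s t s' hp _ ih =>
    refine StepsTo.trans ?_ (ih (fun y => e (some (.inl y))) x fun l => hM (some (.inl l)))
    change some (TM2.stepAux (M (e none)) _ _) = some _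
    rw [hM none, Cmd.compile, TM2.stepAux, hp]
    rfl
  | @ite_false p c₁ c₂ s t s' hp _ ih =>
    refine StepsTo.trans ?_ (ih (fun y => e (some (.inr y))) x fun l => hM (some (.inr l)))
    change some (TM2.stepAux (M (e none)) _ _) = some _
    rw [hM none, Cmd.compile, TM2.stepAux, hp]
    rfl
  | @loop_exit b p c s hp =>
    change some (TM2.stepAux (M (e none)) _ _) = some _
    rw [hM none, Cmd.compile, Blk.stepAux_toStmt, TM2.stepAux, hp]
    rfl
  | @loop_step b p c s t s' t' s'' hp _ _ ih₁ ih₂ =>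
    refine (StepsTo.trans ?_ (ih₁ (fun y => e (some y)) (e none) fun l => hM (some l))).trans
      (ih₂ e x hM)
    change some (TM2.stepAux (M (e none)) _ _) = some _
    rw [hM none, Cmd.compile, Blk.stepAux_toStmt, TM2.stepAux, hp]
    rfl

/-- The stack machine that executes a program and halts. -/
noncomputable def Cmd.machine [Fintype K] [Fintype σ] (c : Cmd Γ σ) (k₀ k₁ : K) [Fintype (Γ k₀)]
    (v : σ) : FinTM2 :=
  haveI := c.finite_pos
  haveI := Fintype.ofFinite c.Pos
  { K := K, k₀ := k₀, k₁ := k₁, Γ := Γ, Λ := Option c.Pos, main := some c.entry, σ := σ,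
    initialState := v
    m := fun l => l.elim .halt (c.compile some none) }

/-- The additional step executes `halt` at the label `none`. -/
theorem Runs.machine_stepsTo [Fintype K] [Fintype σ] {c : Cmd Γ σ} (k₀ k₁ : K) [Fintype (Γ k₀)]
    {v : σ} {s s' : Mem Γ σ} {t : ℕ} (h : Runs c s t s') :
    StepsTo (c.machine k₀ k₁ v).m ⟨some (some c.entry), s.1, s.2⟩ (t + 1) ⟨none, s'.1, s'.2⟩ :=
  (h.stepsTo (M := (c.machine k₀ k₁ v).m) some none fun _ => rfl).trans rfl

/-- Started in `s`, the program `c` ends in `s'` after at most `t` steps. -/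
def RunsIn (c : Cmd Γ σ) (s : Mem Γ σ) (t : ℕ) (s' : Mem Γ σ) : Prop :=
  ∃ t' ≤ t, Runs c s t' s'

theorem RunsIn.mono {c : Cmd Γ σ} {s s' : Mem Γ σ} {t t' : ℕ} (h : RunsIn c s t s')
    (ht : t ≤ t') : RunsIn c s t' s' :=
  let ⟨u, hu, hr⟩ := h
  ⟨u, hu.trans ht, hr⟩

theorem RunsIn.block {b : Blk Γ σ} {s s' : Mem Γ σ} (h : b.eval s = s') :
    RunsIn (.block b) s 1 s' :=
  ⟨1, le_rfl, h ▸ .block b s⟩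

theorem RunsIn.seq {c₁ c₂ : Cmd Γ σ} {s s' s'' : Mem Γ σ} {t t' : ℕ} (h : RunsIn c₁ s t s')
    (h' : RunsIn c₂ s' t' s'') : RunsIn (.seq c₁ c₂) s (t + t') s'' :=
  let ⟨_, hu, hr⟩ := h
  let ⟨_, hu', hr'⟩ := h'
  ⟨_, add_le_add hu hu', hr.seq hr'⟩

theorem RunsIn.ite_true {p : σ → Bool} {c₁ c₂ : Cmd Γ σ} {s s' : Mem Γ σ} {t : ℕ}
    (hp : p s.1 = true) (h : RunsIn c₁ s t s') : RunsIn (.ite p c₁ c₂) s (1 + t) s' :=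
  let ⟨_, hu, hr⟩ := h
  ⟨_, Nat.add_le_add_left hu 1, .ite_true hp hr⟩

theorem RunsIn.ite_false {p : σ → Bool} {c₁ c₂ : Cmd Γ σ} {s s' : Mem Γ σ} {t : ℕ}
    (hp : p s.1 = false) (h : RunsIn c₂ s t s') : RunsIn (.ite p c₁ c₂) s (1 + t) s' :=
  let ⟨_, hu, hr⟩ := h
  ⟨_, Nat.add_le_add_left hu 1, .ite_false hp hr⟩

theorem RunsIn.loop_exit {b : Blk Γ σ} {p : σ → Bool} {c : Cmd Γ σ} {s s' : Mem Γ σ}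
    (h : b.eval s = s') (hp : p s'.1 = false) : RunsIn (.loop b p c) s 1 s' := by
  subst h
  exact ⟨1, le_rfl, .loop_exit hp⟩

theorem RunsIn.loop_step {b : Blk Γ σ} {p : σ → Bool} {c : Cmd Γ σ} {s s₁ s' s'' : Mem Γ σ}
    {t t' : ℕ} (h : b.eval s = s₁) (hp : p s₁.1 = true) (hc : RunsIn c s₁ t s')
    (hl : RunsIn (.loop b p c) s' t' s'') : RunsIn (.loop b p c) s (1 + t + t') s'' := by
  subst h
  obtain ⟨_, hu, hr⟩ := hc
  obtain ⟨_, hu', hr'⟩ := hl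
  exact ⟨_, add_le_add (Nat.add_le_add_left hu 1) hu', .loop_step hp hr hr'⟩

/-- The hypothesis `h` speaks of the remaining run, not of one pass, so that a list element may
stand for several passes of a loop, such as a row read symbol by symbol. -/
theorem RunsIn.foldl {α β : Type*} {c : Cmd Γ σ} (F : List α → β → Mem Γ σ) (f : β → α → β)
    (E T : ℕ) (G : β → Mem Γ σ) (h₀ : ∀ y, RunsIn c (F [] y) E (G y))
    (h : ∀ x l y t s', RunsIn c (F l (f y x)) t s' → RunsIn c (F (x :: l) y) (T + t) s')
    (l : List α) (y : β) : RunsIn c (F l y) (T * l.length + E) (G (l.foldl f y)) := by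
  induction l generalizing y with
  | nil => simpa using h₀ y
  | cons x l ih =>
    refine (h x l y _ _ (ih (f y x))).mono ?_
    rw [List.length_cons]
    linarith

/-- The special case of one pass per list element. -/
theorem RunsIn.loop_foldl {α β : Type*} {b : Blk Γ σ} {p : σ → Bool} {c : Cmd Γ σ}
    (F : List α → β → Mem Γ σ) (f : β → α → β) (T : ℕ)
    (h₀ : ∀ y, b.eval (F [] y) = F [] y ∧ p (F [] y).1 = false)
    (h : ∀ x l y, p (b.eval (F (x :: l) y)).1 = true ∧
      RunsIn c (b.eval (F (x :: l) y)) T (F l (f y x)))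
    (l : List α) (y : β) :
    RunsIn (.loop b p c) (F l y) ((T + 1) * l.length + 1) (F [] (l.foldl f y)) :=
  RunsIn.foldl F f 1 (T + 1) (F []) (fun y => .loop_exit (h₀ y).1 (h₀ y).2)
    (fun x l y _ _ hl => (RunsIn.loop_step rfl (h x l y).1 (h x l y).2 hl).mono (by omega)) l y

end Language

/-! ### The local search as a stack program -/

section LocalSearchProgram

/-- The stacks: the input `inp` and the output `out`; two copies `m`, `w` of the matrix, with `m'`,
`w'` holding the part already read; the rows `r`, `q` of two vertices; the current set `s`; the
triples `z` of entries of `r`, `q`, `s`; the counters `c`, `c'`, `fuel`. -/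
inductive Stack : Type
  | inp | out | m | m' | w | w' | r | q | s | z | c | c' | fuel
  deriving DecidableEq

instance : Fintype Stack where
  elems := {.inp, .out, .m, .m', .w, .w', .r, .q, .s, .z, .c, .c', .fuel}
  complete k := by cases k <;> decide

/-- The alphabets of the stacks. An entry of a row consists of the adjacency bit and of a bit that
marks the diagonal; `none` ends a row. -/
@[reducible]
def Alphabet : Stack → Type
  | .inp => Option Bool
  | .out | .s => Bool
  | .m | .m' | .w | .w' => Option (Bool × Bool)
  | .r | .q => Bool × Bool
  | .z => (Bool × Bool) × (Bool × Bool) × Bool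
  | .c | .c' | .fuel => Unit

/-- The contents of the stacks. -/
structure Store : Type where
  inp : List (Option Bool) := []
  out : List Bool := []
  m : List (Option (Bool × Bool)) := []
  m' : List (Option (Bool × Bool)) := []
  w : List (Option (Bool × Bool)) := []
  w' : List (Option (Bool × Bool)) := []
  r : List (Bool × Bool) := []
  q : List (Bool × Bool) := []
  s : List Bool := []
  z : List ((Bool × Bool) × (Bool × Bool) × Bool) := []
  c : List Unit := []
  c' : List Unit := []
  fuel : List Unit := []

/-- The contents of the stacks as a function on stacks. -/
def Store.stk (S : Store) : (k : Stack) → List (Alphabet k)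
  | .inp => S.inp
  | .out => S.out
  | .m => S.m
  | .m' => S.m'
  | .w => S.w
  | .w' => S.w'
  | .r => S.r
  | .q => S.q
  | .s => S.s
  | .z => S.z
  | .c => S.c
  | .c' => S.c'
  | .fuel => S.fuel

namespace Store

variable (S : Store)

/-- With these rewritings `simp` executes pushes and pops symbolically, as changes of single fields.
-/
theorem update_inp (l) : Function.update S.stk .inp l = stk { S with inp := l } := by
  funext k; cases k <;> rfl
theorem update_out (l) : Function.update S.stk .out l = stk { S with out := l } := by
  funext k; cases k <;> rfl
theorem update_m (l) : Function.update S.stk .m l = stk { S with m := l } := by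
  funext k; cases k <;> rfl
theorem update_m' (l) : Function.update S.stk .m' l = stk { S with m' := l } := by
  funext k; cases k <;> rfl
theorem update_w (l) : Function.update S.stk .w l = stk { S with w := l } := by
  funext k; cases k <;> rfl
theorem update_w' (l) : Function.update S.stk .w' l = stk { S with w' := l } := by
  funext k; cases k <;> rfl
theorem update_r (l) : Function.update S.stk .r l = stk { S with r := l } := by
  funext k; cases k <;> rfl
theorem update_q (l) : Function.update S.stk .q l = stk { S with q := l } := by
  funext k; cases k <;> rfl
theorem update_s (l) : Function.update S.stk .s l = stk { S with s := l } := by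
  funext k; cases k <;> rfl
theorem update_z (l) : Function.update S.stk .z l = stk { S with z := l } := by
  funext k; cases k <;> rfl
theorem update_c (l) : Function.update S.stk .c l = stk { S with c := l } := by
  funext k; cases k <;> rfl
theorem update_c' (l) : Function.update S.stk .c' l = stk { S with c' := l } := by
  funext k; cases k <;> rfl
theorem update_fuel (l) : Function.update S.stk .fuel l = stk { S with fuel := l } := by
  funext k; cases k <;> rfl

end Store

/-- Statistics of an attempted exchange: whether the two vertices are adjacent, and the numbers of
vertices that would be lost and won, both cut off at `2`. -/
abbrev Stats : Type := Bool × Fin 3 × Fin 3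

/-- Adding one to a counter that is cut off at `2`. -/
def bump (p : Bool) (a : Fin 3) : Fin 3 :=
  if p then if a = 2 then 2 else a + 1 else a

/-- Taking into account an entry of the rows `r`, `q` of the two vertices and of the current set. -/
def Stats.add (a : Stats) (x : (Bool × Bool) × (Bool × Bool) × Bool) : Stats :=
  (a.1 || (x.2.1.2 && x.1.1), bump (x.2.2 && (x.1.1 || x.2.1.1)) a.2.1,
    bump (!x.2.2 && (x.1.2 || x.2.1.2)) a.2.2)

/-- The exchange is possible and enlarges the set. -/
def Stats.good (a : Stats) : Bool :=
  !a.1 && decide (a.2.1 < a.2.2)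

/-- The entry of the set after an exchange. -/
def exchanged (x : (Bool × Bool) × (Bool × Bool) × Bool) : Bool :=
  x.1.2 || x.2.1.2 || (x.2.2 && !(x.1.1 || x.2.1.1))

/-- The register: for each alphabet the symbol read last, a flag and the statistics. -/
structure Reg : Type where
  inp : Option (Option Bool) := none
  sym : Option (Option (Bool × Bool)) := none
  unit : Option Unit := none
  r : Option (Bool × Bool) := none
  q : Option (Bool × Bool) := none
  s : Option Bool := none
  z : Option ((Bool × Bool) × (Bool × Bool) × Bool) := none
  flag : Bool := false
  stats : Stats := (false, 0, 0)

noncomputable instance : Fintype Reg :=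
  Fintype.ofInjective
    (fun v : Reg => (v.inp, v.sym, v.unit, v.r, v.q, v.s, v.z, v.flag, v.stats)) <| by
      rintro ⟨⟩ ⟨⟩ h
      simpa using h

/-- The triple of entries read last. -/
def Reg.triple (v : Reg) : (Bool × Bool) × (Bool × Bool) × Bool :=
  (v.r.getD (false, false), v.q.getD (false, false), v.s.getD false)

open Blk Cmd

/-- Programs with these stacks and this register. -/
abbrev Prog : Type := Cmd Alphabet Reg

/-- Read the row entries on `m'` back to `m`. -/
def rewindM : Prog :=
  loop (pop .m' (fun v x => { v with sym := x }) nil) (fun v => v.sym.isSome)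
    (block (push .m (fun v => v.sym.getD none) (load (fun _ => {}) nil)))

/-- Read the row entries on `w'` back to `w`. -/
def rewindW : Prog :=
  loop (pop .w' (fun v x => { v with sym := x }) nil) (fun v => v.sym.isSome)
    (block (push .w (fun v => v.sym.getD none) (load (fun _ => {}) nil)))

def clearM : Prog :=
  loop (pop .m (fun v x => { v with sym := x }) nil) (fun v => v.sym.isSome)
    (block (load (fun _ => {}) nil))

def clearW : Prog :=
  loop (pop .w (fun v x => { v with sym := x }) nil) (fun v => v.sym.isSome)
    (block (load (fun _ => {}) nil))

def clearR : Prog :=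
  loop (pop .r (fun v x => { v with r := x }) nil) (fun v => v.r.isSome)
    (block (load (fun _ => {}) nil))

def outputSet : Prog :=
  loop (pop .s (fun v x => { v with s := x }) nil) (fun v => v.s.isSome)
    (block (push .out (fun v => v.s.getD false) (load (fun _ => {}) nil)))

/-- Distribute the matrix on `m'` to `m` and `w`, and count its symbols. -/
def copyMatrix : Prog :=
  loop (pop .m' (fun v x => { v with sym := x }) nil) (fun v => v.sym.isSome)
    (block (push .m (fun v => v.sym.getD none) (push .w (fun v => v.sym.getD none)
      (push .fuel (fun _ => ()) (load (fun _ => {}) nil)))))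

/-- Put the empty set on `s`. -/
def initSet : Prog :=
  loop (pop .c (fun v x => { v with unit := x }) nil) (fun v => v.unit.isSome)
    (block (push .s (fun _ => false) (load (fun _ => {}) nil)))

def rewindC : Prog :=
  loop (pop .c' (fun v x => { v with unit := x }) nil) (fun v => v.unit.isSome)
    (block (push .c (fun _ => ()) (load (fun _ => {}) nil)))

/-- Read one entry of a row, and mark it if the counter `c` is exhausted for the first time. -/
def tagEntry : Prog :=
  block (pop .c (fun v x => { v with unit := x })
    (ite (fun v => v.unit.isSome)
      (push .c' (fun _ => ()) (push .m' (fun v => some ((v.inp.getD none).getD false, false)) nil))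
      (ite (fun v => v.flag)
        (push .m' (fun v => some ((v.inp.getD none).getD false, false)) nil)
        (push .c' (fun _ => ())
          (push .m' (fun v => some ((v.inp.getD none).getD false, true))
            (load (fun v => { v with flag := true }) nil)))
        nil)
      (load (fun v => { flag := v.flag }) nil)))

/-- Read the input, and mark the diagonal entries. -/
def readInput : Prog :=
  loop (pop .inp (fun v x => { v with inp := x }) nil) (fun v => v.inp.isSome)
    (Cmd.ite (fun v => (v.inp.getD none).isSome) tagEntry
      (seq (block (push .m' (fun _ => none) (load (fun _ => {}) nil))) rewindC))

/-- Compute the statistics of the exchange. -/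
def scanPair : Prog :=
  loop (pop .q (fun v x => { v with q := x }) (pop .r (fun v x => { v with r := x })
      (pop .s (fun v x => { v with s := x }) nil))) (fun v => v.q.isSome)
    (block (push .z (fun v => v.triple)
      (load (fun v => { stats := Stats.add v.stats v.triple }) nil)))

/-- Restore `r` and `s`, carrying out the exchange if the flag is set. -/
def applyPair : Prog :=
  loop (pop .z (fun v x => { v with z := x }) nil) (fun v => v.z.isSome)
    (block (push .r (fun v => (v.z.getD default).1)
      (push .s (fun v => cond v.flag (exchanged (v.z.getD default)) (v.z.getD default).2.2)
        (load (fun v => { flag := v.flag }) nil))))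

/-- Try to bring the vertices of the rows `r` and `q` into the set. -/
def tryPair : Prog :=
  seq scanPair (seq (block (load (fun v => { flag := Stats.good v.stats }) nil))
    (seq applyPair (block (load (fun _ => {}) nil))))

/-- Try the vertex of the row `r` with all vertices. -/
def tryVertex : Prog :=
  loop (pop .w (fun v x => { v with sym := x }) nil) (fun v => v.sym.isSome)
    (Cmd.ite (fun v => (v.sym.getD none).isSome)
      (block (push .w' (fun v => v.sym.getD none)
        (push .q (fun v => (v.sym.getD none).getD (false, false)) (load (fun _ => {}) nil))))
      (seq (block (push .w' (fun _ => none) (load (fun _ => {}) nil))) tryPair))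

/-- Try all pairs of vertices. -/
def tryAll : Prog :=
  loop (pop .m (fun v x => { v with sym := x }) nil) (fun v => v.sym.isSome)
    (Cmd.ite (fun v => (v.sym.getD none).isSome)
      (block (push .m' (fun v => v.sym.getD none)
        (push .r (fun v => (v.sym.getD none).getD (false, false)) (load (fun _ => {}) nil))))
      (seq (block (push .m' (fun _ => none) (load (fun _ => {}) nil)))
        (seq tryVertex (seq rewindW clearR))))

/-- Repeat the search for exchanges as often as the counter `fuel` says. -/
def iterateSearch : Prog :=
  loop (pop .fuel (fun v x => { v with unit := x }) nil) (fun v => v.unit.isSome)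
    (seq (block (load (fun _ => {}) nil)) (seq tryAll rewindM))

/-- Local search for a large independent set. -/
def localSearch : Prog :=
  seq readInput (seq copyMatrix (seq initSet (seq iterateSearch
    (seq clearM (seq clearW outputSet)))))

/-- The state of the memory. -/
def mem (v : Reg) (S : Store) : Mem Alphabet Reg := (v, S.stk)

-- Effect and running time of the elementary loops

attribute [local simp] mem Reg.triple Blk.eval Store.stk Store.update_inp Store.update_out
  Store.update_m Store.update_m' Store.update_w Store.update_w' Store.update_r Store.update_q
  Store.update_s Store.update_z Store.update_c Store.update_c' Store.update_fuel

/-- Moving one stack onto another reverses it. -/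
theorem foldl_flip_cons {α : Type*} (l y : List α) :
    l.foldl (fun y x => x :: y) y = l.reverse ++ y := by
  induction l generalizing y with
  | nil => rfl
  | cons x l ih => simp [ih]

theorem rewindM_runsIn (S : Store) :
    RunsIn rewindM (mem {} S) (2 * S.m'.length + 1)
      (mem {} { S with m' := [], m := S.m'.reverse ++ S.m }) := by
  rw [← foldl_flip_cons]
  exact RunsIn.loop_foldl (fun l y => mem {} { S with m' := l, m := y }) (fun y x => x :: y) 1
    (fun y => by simp) (fun x l y => ⟨by simp, RunsIn.block (by simp)⟩) S.m' S.m

theorem rewindW_runsIn (S : Store) :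
    RunsIn rewindW (mem {} S) (2 * S.w'.length + 1)
      (mem {} { S with w' := [], w := S.w'.reverse ++ S.w }) := by
  rw [← foldl_flip_cons]
  exact RunsIn.loop_foldl (fun l y => mem {} { S with w' := l, w := y }) (fun y x => x :: y) 1
    (fun y => by simp) (fun x l y => ⟨by simp, RunsIn.block (by simp)⟩) S.w' S.w

theorem rewindC_runsIn (S : Store) :
    RunsIn rewindC (mem {} S) (2 * S.c'.length + 1)
      (mem {} { S with c' := [], c := S.c'.reverse ++ S.c }) := by
  rw [← foldl_flip_cons]
  exact RunsIn.loop_foldl (fun l y => mem {} { S with c' := l, c := y }) (fun y x => x :: y) 1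
    (fun y => by simp) (fun x l y => ⟨by simp, RunsIn.block (by simp)⟩) S.c' S.c

theorem clearM_runsIn (S : Store) :
    RunsIn clearM (mem {} S) (2 * S.m.length + 1) (mem {} { S with m := [] }) :=
  RunsIn.loop_foldl (fun l (_ : Unit) => mem {} { S with m := l }) (fun y _ => y) 1
    (fun y => by simp) (fun x l y => ⟨by simp, RunsIn.block (by simp)⟩) S.m ()

theorem clearW_runsIn (S : Store) :
    RunsIn clearW (mem {} S) (2 * S.w.length + 1) (mem {} { S with w := [] }) :=
  RunsIn.loop_foldl (fun l (_ : Unit) => mem {} { S with w := l }) (fun y _ => y) 1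
    (fun y => by simp) (fun x l y => ⟨by simp, RunsIn.block (by simp)⟩) S.w ()

theorem clearR_runsIn (S : Store) :
    RunsIn clearR (mem {} S) (2 * S.r.length + 1) (mem {} { S with r := [] }) :=
  RunsIn.loop_foldl (fun l (_ : Unit) => mem {} { S with r := l }) (fun y _ => y) 1
    (fun y => by simp) (fun x l y => ⟨by simp, RunsIn.block (by simp)⟩) S.r ()

theorem outputSet_runsIn (S : Store) :
    RunsIn outputSet (mem {} S) (2 * S.s.length + 1)
      (mem {} { S with s := [], out := S.s.reverse ++ S.out }) := by
  rw [← foldl_flip_cons]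
  exact RunsIn.loop_foldl (fun l y => mem {} { S with s := l, out := y }) (fun y x => x :: y) 1
    (fun y => by simp) (fun x l y => ⟨by simp, RunsIn.block (by simp)⟩) S.s S.out

theorem copyMatrix_runsIn (l : List (Option (Bool × Bool))) (S : Store) :
    RunsIn copyMatrix (mem {} { S with m' := l, m := [], w := [], fuel := [] })
      (2 * l.length + 1)
      (mem {}
        { S with m' := [], m := l.reverse, w := l.reverse, fuel := .replicate l.length () }) := by
  have h := RunsIn.loop_foldl (fun l (y : List (Option (Bool × Bool))) =>
      mem {} { S with m' := l, m := y, w := y, fuel := List.replicate y.length () })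
    (fun y x => x :: y) 1 (b := pop .m' (fun v x => { v with sym := x }) nil)
    (p := fun v => v.sym.isSome)
    (c := block (push .m (fun v => v.sym.getD none) (push .w (fun v => v.sym.getD none)
      (push .fuel (fun _ => ()) (load (fun _ => {}) nil)))))
    (fun y => by simp) (fun x l y => ⟨by simp, RunsIn.block (by simp; rfl)⟩) l []
  rw [foldl_flip_cons, List.append_nil, List.length_reverse] at h
  exact h

theorem initSet_runsIn (n : ℕ) (S : Store) :
    RunsIn initSet (mem {} { S with c := List.replicate n (), s := [] }) (2 * n + 1)
      (mem {} { S with c := [], s := List.replicate n false }) := by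
  have h := RunsIn.loop_foldl (fun l (y : ℕ) =>
      mem {} { S with c := l, s := List.replicate y false })
    (fun y _ => y + 1) 1 (b := pop .c (fun v x => { v with unit := x }) nil)
    (p := fun v => v.unit.isSome)
    (c := block (push .s (fun _ => false) (load (fun _ => {}) nil)))
    (fun y => by simp) (fun x l y => ⟨by simp, RunsIn.block (by simp; rfl)⟩)
    (List.replicate n ()) 0
  simpa [initSet] using h

/-! ### Attempted exchanges and rounds of the search -/

variable {α β : Type*}

/-- The statistics of the exchange given by two rows and a set. -/
def pairStats (L : List α) (f g : α → Bool × Bool) (h : α → Bool) : Stats :=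
  L.foldl (fun a x => Stats.add a (f x, g x, h x)) (false, 0, 0)

/-- The set after an attempted exchange. -/
def tryRows (L : List α) (f g : α → Bool × Bool) (h : α → Bool) : α → Bool :=
  cond (Stats.good (pairStats L f g h)) (fun x => exchanged (f x, g x, h x)) h

theorem scanPair_runsIn (L : List α) (f g : α → Bool × Bool) (h : α → Bool) (S : Store) :
    RunsIn scanPair (mem {} { S with r := L.map f, q := L.map g, s := L.map h, z := [] })
      (2 * L.length + 1)
      (mem { stats := pairStats L f g h }
        { S with r := [], q := [], s := [], z := (L.map fun x => (f x, g x, h x)).reverse }) := by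
  have H := RunsIn.foldl (c := scanPair)
    (fun (l : List α) (y : Stats × List ((Bool × Bool) × (Bool × Bool) × Bool)) =>
      mem { stats := y.1 } { S with r := l.map f, q := l.map g, s := l.map h, z := y.2 })
    (fun y x => (Stats.add y.1 (f x, g x, h x), (f x, g x, h x) :: y.2)) 1 2
    (fun y => mem { stats := y.1 } { S with r := [], q := [], s := [], z := y.2 })
    (fun y => by
      unfold scanPair
      exact RunsIn.loop_exit (by simp) (by simp))
    (fun x l y t s' hl => by
      unfold scanPair at *
      exact RunsIn.loop_step rfl (by simp) (RunsIn.block (by simp)) hl)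
    L ((false, 0, 0), [])
  -- The two components of the fold do not interact: one collects the statistics, the other stores
  -- the triples in reverse.
  have e : L.foldl (fun (y : Stats × List ((Bool × Bool) × (Bool × Bool) × Bool)) x =>
      (Stats.add y.1 (f x, g x, h x), (f x, g x, h x) :: y.2)) ((false, 0, 0), []) =
      (pairStats L f g h, (L.map fun x => (f x, g x, h x)).reverse) := by
    have : ∀ a l, L.foldl (fun (y : Stats × List ((Bool × Bool) × (Bool × Bool) × Bool)) x =>
        (Stats.add y.1 (f x, g x, h x), (f x, g x, h x) :: y.2)) (a, l) =
        (L.foldl (fun a x => Stats.add a (f x, g x, h x)) a,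
          (L.map fun x => (f x, g x, h x)).reverse ++ l) := by
      clear H
      induction L with
      | nil => simp
      | cons x L ih => intro a l; simp [ih]
    simpa [pairStats] using this (false, 0, 0) []
  rw [e] at H
  exact H

/-- The triples leave `z` in the reverse order of the scan, so pushing them restores the original
order of `r` and `s`. -/
theorem applyPair_runsIn (v : Bool) (L : List ((Bool × Bool) × (Bool × Bool) × Bool)) (S : Store) :
    RunsIn applyPair (mem { flag := v } { S with r := [], s := [], z := L.reverse })
      (2 * L.length + 1)
      (mem { flag := v }
        { S with z := [], r := L.map (·.1), s := L.map fun x => cond v (exchanged x) x.2.2 }) := by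
  have H := RunsIn.loop_foldl (fun l (y : List ((Bool × Bool) × (Bool × Bool) × Bool)) =>
      mem { flag := v }
        { S with z := l, r := y.map (·.1), s := y.map fun x => cond v (exchanged x) x.2.2 })
    (fun y x => x :: y) 1 (b := pop .z (fun v x => { v with z := x }) nil)
    (p := fun v => v.z.isSome)
    (c := block (push .r (fun v => (v.z.getD default).1)
      (push .s (fun v => cond v.flag (exchanged (v.z.getD default)) (v.z.getD default).2.2)
        (load (fun v => { flag := v.flag }) nil))))
    (fun y => by simp) (fun x l y => ⟨by simp, RunsIn.block (by simp)⟩) L.reverse []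
  rw [foldl_flip_cons, List.append_nil, List.reverse_reverse, List.length_reverse] at H
  exact H

theorem tryPair_runsIn (L : List α) (f g : α → Bool × Bool) (h : α → Bool) (S : Store) :
    RunsIn tryPair (mem {} { S with r := L.map f, q := L.map g, s := L.map h, z := [] })
      (4 * L.length + 4)
      (mem {} { S with r := L.map f, q := [], s := L.map (tryRows L f g h), z := [] }) := by
  refine ((scanPair_runsIn L f g h S).seq (.seq (.block (by simp))
    (.seq (applyPair_runsIn (Stats.good (pairStats L f g h)) (L.map fun x => (f x, g x, h x))
      { S with q := [], r := [], s := [] }) (.block ?_)))).mono (by simp; omega)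
  have e : tryRows L f g h = fun x =>
      cond (Stats.good (pairStats L f g h)) (exchanged (f x, g x, h x)) (h x) := by
    unfold tryRows
    cases Stats.good (pairStats L f g h) <;> rfl
  rw [e]
  simp [Function.comp_def]

/-- The matrix with rows indexed by `J` and columns indexed by `L`, with `none` after each row. -/
def matrixList (L : List α) (g : β → α → Bool × Bool) (J : List β) : List (Option (Bool × Bool)) :=
  J.flatMap fun j => (L.map (g j)).map some ++ [none]

theorem length_matrixList (L : List α) (g : β → α → Bool × Bool) (J : List β) :
    (matrixList L g J).length = J.length * (L.length + 1) := by
  simp [matrixList, List.length_flatMap]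

/-- Three steps per symbol: loop test, branch and block. The rest of the run is a hypothesis because
reading a row takes many passes of the same loop. -/
theorem tryVertex_readRow (l : List (Bool × Bool)) (S : Store) (t : ℕ) (s' : Mem Alphabet Reg)
    (h : RunsIn tryVertex
      (mem {} { S with w' := (l.map some).reverse ++ S.w', q := l.reverse ++ S.q }) t s') :
    RunsIn tryVertex (mem {} { S with w := l.map some ++ S.w }) (3 * l.length + t) s' := by
  induction l generalizing S t with
  | nil => simpa using h
  | cons x l ih =>
    refine RunsIn.mono (t := 1 + (1 + 1) + (3 * l.length + t)) ?_ (by simp; omega)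
    refine RunsIn.loop_step rfl (by simp) (.ite_true (by simp) (.block rfl)) ?_
    simpa [tryVertex] using ih { S with w' := some x :: S.w', q := x :: S.q } t (by simpa using h)

/-- Reading a row onto `r` or `q` reverses it; `s` is kept in the order `L.reverse` as well, so that
the tops of the three stacks always belong to the same vertex. -/
theorem tryVertex_runsIn (L : List α) (f : α → Bool × Bool) (g : β → α → Bool × Bool) (J : List β)
    (h : α → Bool) (S : Store) :
    RunsIn tryVertex (mem {} { S with
        w := matrixList L g J
        w' := []
        r := L.reverse.map f
        q := []
        s := L.reverse.map h
        z := [] })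
      ((7 * L.length + 7) * J.length + 1)
      (mem {} { S with
        w := []
        w' := (matrixList L g J).reverse
        r := L.reverse.map f
        q := []
        s := L.reverse.map (J.foldl (fun h j => tryRows L.reverse f (g j) h) h)
        z := [] }) := by
  have H := RunsIn.foldl (c := tryVertex)
    (fun (J : List β) (y : List (Option (Bool × Bool)) × (α → Bool)) => mem {} { S with
        w := matrixList L g J
        w' := y.1
        r := L.reverse.map f
        q := []
        s := L.reverse.map y.2
        z := [] })
    (fun y j => (none :: ((L.map (g j)).map some).reverse ++ y.1, tryRows L.reverse f (g j) y.2))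
    1 (7 * L.length + 7)
    (fun y => mem {} { S with
        w := []
        w' := y.1
        r := L.reverse.map f
        q := []
        s := L.reverse.map y.2
        z := [] })
    (fun y => RunsIn.loop_exit (by simp [matrixList]) (by simp))
    (fun j J y t s' hl => ?_) J ([], h)
  · have e : J.foldl (fun (y : List (Option (Bool × Bool)) × (α → Bool)) j =>
        (none :: ((L.map (g j)).map some).reverse ++ y.1, tryRows L.reverse f (g j) y.2)) ([], h) =
        ((matrixList L g J).reverse, J.foldl (fun h j => tryRows L.reverse f (g j) h) h) := by
      clear H
      suffices ∀ y : List (Option (Bool × Bool)) × (α → Bool),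
          J.foldl (fun (y : List (Option (Bool × Bool)) × (α → Bool)) j =>
            (none :: ((L.map (g j)).map some).reverse ++ y.1, tryRows L.reverse f (g j) y.2)) y =
          ((matrixList L g J).reverse ++ y.1,
            J.foldl (fun h j => tryRows L.reverse f (g j) h) y.2) by simpa using this ([], h)
      induction J with
      | nil => intro y; simp [matrixList]
      | cons j J ih => intro y; rw [List.foldl_cons, ih]; simp [matrixList]
    rw [e] at H
    exact H
  -- After the row: loop test, branch, storing the end of the row, one attempted exchange, and then
  -- the remaining rows.
  · have h₁ := tryVertex_readRow (L.map (g j)) { S with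
        w := none :: matrixList L g J
        w' := y.1
        r := L.reverse.map f
        q := []
        s := L.reverse.map y.2
        z := [] } (1 + (1 + (1 + (4 * L.length + 4))) + t) s' ?_
    · simp only [List.length_map] at h₁
      refine RunsIn.mono ?_ (t := 3 * L.length + (1 + (1 + (1 + (4 * L.length + 4))) + t))
        (by omega)
      simpa [matrixList] using h₁
    · refine RunsIn.loop_step rfl (by simp) (.ite_false (by simp) (.seq (.block rfl) ?_)) hl
      have h₂ := tryPair_runsIn L.reverse f (g j) y.2 { S with
        w := matrixList L g J
        w' := none :: ((L.map (g j)).map some).reverse ++ y.1 }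
      simpa using h₂

theorem tryAll_readRow (l : List (Bool × Bool)) (S : Store) (t : ℕ) (s' : Mem Alphabet Reg)
    (h : RunsIn tryAll
      (mem {} { S with m' := (l.map some).reverse ++ S.m', r := l.reverse ++ S.r }) t s') :
    RunsIn tryAll (mem {} { S with m := l.map some ++ S.m }) (3 * l.length + t) s' := by
  induction l generalizing S t with
  | nil => simpa using h
  | cons x l ih =>
    refine RunsIn.mono (t := 1 + (1 + 1) + (3 * l.length + t)) ?_ (by simp; omega)
    refine RunsIn.loop_step rfl (by simp) (.ite_true (by simp) (.block rfl)) ?_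
    simpa [tryAll] using ih { S with m' := some x :: S.m', r := x :: S.r } t (by simpa using h)

/-- One round of the local search: the exchanges of all pairs are tried. -/
def searchRound (L : List α) (g : β → α → Bool × Bool) (J : List β) (h : α → Bool) : α → Bool :=
  J.foldl (fun h i => J.foldl (fun h j => tryRows L.reverse (g i) (g j) h) h) h

theorem tryAll_runsIn (L : List α) (g : β → α → Bool × Bool) (J : List β)
    (h : α → Bool) (S : Store) :
    RunsIn tryAll (mem {} { S with
        m := matrixList L g J
        m' := []
        w := matrixList L g J
        w' := []
        r := []
        q := []
        s := L.reverse.map h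
        z := [] })
      ((9 * (J.length * (L.length + 1)) + 5 * L.length + 6) * J.length + 1)
      (mem {} { S with
        m := []
        m' := (matrixList L g J).reverse
        w := matrixList L g J
        w' := []
        r := []
        q := []
        s := L.reverse.map (searchRound L g J h)
        z := [] }) := by
  have H := RunsIn.foldl (c := tryAll)
    (fun (I : List β) (y : List (Option (Bool × Bool)) × (α → Bool)) => mem {} { S with
        m := matrixList L g I
        m' := y.1
        w := matrixList L g J
        w' := []
        r := []
        q := []
        s := L.reverse.map y.2
        z := [] })
    (fun y i => (none :: ((L.map (g i)).map some).reverse ++ y.1,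
      J.foldl (fun h j => tryRows L.reverse (g i) (g j) h) y.2))
    1 (9 * (J.length * (L.length + 1)) + 5 * L.length + 6)
    (fun y => mem {} { S with
        m := []
        m' := y.1
        w := matrixList L g J
        w' := []
        r := []
        q := []
        s := L.reverse.map y.2
        z := [] })
    (fun y => RunsIn.loop_exit (by simp [matrixList]) (by simp))
    (fun i I y t s' hl => ?_) J ([], h)
  · have e : ∀ (I : List β) (y : List (Option (Bool × Bool)) × (α → Bool)),
        I.foldl (fun (y : List (Option (Bool × Bool)) × (α → Bool)) i =>
          (none :: ((L.map (g i)).map some).reverse ++ y.1,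
            J.foldl (fun h j => tryRows L.reverse (g i) (g j) h) y.2)) y =
        ((matrixList L g I).reverse ++ y.1,
          I.foldl (fun h i => J.foldl (fun h j => tryRows L.reverse (g i) (g j) h) h) y.2) := by
      intro I
      induction I with
      | nil => intro y; simp [matrixList]
      | cons i I ih => intro y; rw [List.foldl_cons, ih]; simp [matrixList]
    rw [e, List.append_nil] at H
    exact H
  -- After the row: loop test, branch, storing the end of the row, the pass over all second
  -- vertices, rewinding `w`, clearing `r`, and then the remaining rows.
  · have h₁ := tryAll_readRow (L.map (g i)) { S with
        m := none :: matrixList L g I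
        m' := y.1
        w := matrixList L g J
        w' := []
        r := []
        q := []
        s := L.reverse.map y.2
        z := [] } (1 + (1 + (1 + (((7 * L.length + 7) * J.length + 1) +
          ((2 * (J.length * (L.length + 1)) + 1) + (2 * L.length + 1))))) + t) s' ?_
    · simp only [List.length_map] at h₁
      refine RunsIn.mono (t := 3 * L.length + (1 + (1 + (1 + (((7 * L.length + 7) * J.length + 1) +
          ((2 * (J.length * (L.length + 1)) + 1) + (2 * L.length + 1))))) + t)) ?_ (by linarith)
      simpa [matrixList] using h₁
    · refine RunsIn.loop_step rfl (by simp) (.ite_false (by simp) (.seq (.block rfl) ?_)) hl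
      have h₂ := tryVertex_runsIn L (g i) g J y.2 { S with
        m := matrixList L g I
        m' := none :: ((L.map (g i)).map some).reverse ++ y.1 }
      have h₃ := h₂.seq ((rewindW_runsIn _).seq (clearR_runsIn _))
      simpa [length_matrixList] using h₃

theorem iterateSearch_runsIn (L : List α) (g : β → α → Bool × Bool) (J : List β)
    (h : α → Bool) (N : ℕ) (S : Store) :
    RunsIn iterateSearch (mem {} { S with
        m := matrixList L g J
        m' := []
        w := matrixList L g J
        w' := []
        r := []
        q := []
        s := L.reverse.map h
        z := []
        fuel := List.replicate N () })
      (((9 * (J.length * (L.length + 1)) + 5 * L.length + 6) * J.length +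
        2 * (J.length * (L.length + 1)) + 4) * N + 1)
      (mem {} { S with
        m := matrixList L g J
        m' := []
        w := matrixList L g J
        w' := []
        r := []
        q := []
        s := L.reverse.map ((searchRound L g J)^[N] h)
        z := []
        fuel := [] }) := by
  have H := RunsIn.foldl (c := iterateSearch) (fun (l : List Unit) (h : α → Bool) => mem {} { S with
        m := matrixList L g J
        m' := []
        w := matrixList L g J
        w' := []
        r := []
        q := []
        s := L.reverse.map h
        z := []
        fuel := l }) (fun h _ => searchRound L g J h) 1
      ((9 * (J.length * (L.length + 1)) + 5 * L.length + 6) * J.length +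
        2 * (J.length * (L.length + 1)) + 4)
    _ (fun y => RunsIn.loop_exit rfl (by simp)) (fun x l y t s' hl => ?_) (List.replicate N ()) h
  · rw [List.length_replicate, List.foldl_const, List.length_replicate] at H
    simpa using H
  · refine RunsIn.mono (t := 1 + (1 + (((9 * (J.length * (L.length + 1)) + 5 * L.length + 6) *
      J.length + 1) + (2 * (J.length * (L.length + 1)) + 1))) + t) ?_ (by linarith)
    refine RunsIn.loop_step rfl (by simp) (.seq (.block rfl) ?_) hl
    have h₂ := (tryAll_runsIn L g J y { S with fuel := l }).seq (rewindM_runsIn _)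
    simpa [length_matrixList] using h₂

/-! ### Reading the input and marking the diagonal -/

/-- Mark the entry with index `k` of a row. -/
def tagRow : ℕ → List Bool → List (Bool × Bool)
  | _, [] => []
  | 0, b :: l => (b, true) :: l.map (·, false)
  | k + 1, b :: l => (b, false) :: tagRow k l

/-- Mark the entry with index `k` of the first row, `k + 1` of the second row, and so on. -/
def tagMatrix : ℕ → List (List Bool) → List (Option (Bool × Bool))
  | _, [] => []
  | k, r :: R => (tagRow k r).map some ++ none :: tagMatrix (k + 1) R

/-- Beyond the diagonal `c` is empty and the flag is set, so nothing more is marked or counted. -/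
theorem readInput_readTail (l : List Bool) (S : Store) (t : ℕ) (s' : Mem Alphabet Reg)
    (h : RunsIn readInput (mem { flag := true }
      { S with c := [], m' := ((l.map (·, false)).map some).reverse ++ S.m' }) t s') :
    RunsIn readInput (mem { flag := true } { S with c := [], inp := l.map some ++ S.inp })
      (3 * l.length + t) s' := by
  induction l generalizing S t with
  | nil => simpa using h
  | cons x l ih =>
    refine RunsIn.mono (t := 1 + (1 + 1) + (3 * l.length + t)) ?_ (by simp; omega)
    refine RunsIn.loop_step rfl (by simp) (.ite_true (by simp) (.block rfl)) ?_
    simpa [readInput] using ih { S with m' := some (x, false) :: S.m' } t (by simpa using h)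

/-- Row `k` starts with `k` units on `c`, which move to `c'` one per entry. The entry that first
finds `c` empty is the diagonal one; it adds a further unit, so `c'` is ready for row `k + 1`. -/
theorem readInput_readRow (l : List Bool) (k : ℕ) (hk : k < l.length) (S : Store) (t : ℕ)
    (s' : Mem Alphabet Reg)
    (h : RunsIn readInput (mem { flag := true }
      { S with
        c := []
        c' := List.replicate (k + 1) () ++ S.c'
        m' := ((tagRow k l).map some).reverse ++ S.m' }) t s') :
    RunsIn readInput (mem {} { S with c := List.replicate k (), inp := l.map some ++ S.inp })
      (3 * l.length + t) s' := by
  induction l generalizing S t k with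
  | nil => simp at hk
  | cons x l ih =>
    refine RunsIn.mono (t := 1 + (1 + 1) + (3 * l.length + t)) ?_ (by simp; omega)
    refine RunsIn.loop_step rfl (by simp) (.ite_true (by simp) (.block rfl)) ?_
    cases k with
    | zero =>
      simpa [readInput] using readInput_readTail l
        { S with c' := () :: S.c', m' := some (x, true) :: S.m' } t _ (by simpa [tagRow] using h)
    | succ k =>
      have e : List.replicate (k + 1 + 1) () ++ S.c' = List.replicate (k + 1) () ++ () :: S.c' := by
        rw [List.replicate_succ' (n := k + 1), List.append_assoc, List.singleton_append]
      rw [e] at h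
      simpa [readInput, List.replicate_succ] using ih k (by simpa using hk)
        { S with c' := () :: S.c', m' := some (x, false) :: S.m' } t (by simpa [tagRow] using h)

/-- The bound `hk` ensures that each row is long enough to contain its diagonal entry. -/
theorem readInput_runsIn (n : ℕ) (R : List (List Bool)) (k : ℕ) (hR : ∀ r ∈ R, r.length = n)
    (hk : k + R.length ≤ n) (S : Store) :
    RunsIn readInput (mem {} { S with
        inp := R.flatMap fun r => r.map some ++ [none]
        c := List.replicate k ()
        c' := [] })
      ((5 * n + 4) * R.length + 1)
      (mem {} { S with
        inp := []
        c := List.replicate (k + R.length) ()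
        c' := []
        m' := (tagMatrix k R).reverse ++ S.m' }) := by
  induction R generalizing k S with
  | nil => exact RunsIn.loop_exit (by simp [tagMatrix]) (by simp)
  | cons r R ih =>
    have hr : r.length = n := hR r (by simp)
    rw [List.length_cons] at hk
    have h₁ := readInput_readRow r k (by omega) { S with
        inp := none :: R.flatMap fun r => r.map some ++ [none]
        c' := [] } (1 + (1 + (1 + (2 * (k + 1) + 1))) + ((5 * n + 4) * R.length + 1))
      (mem {} { S with
        inp := []
        c := List.replicate (k + (r :: R).length) ()
        c' := []
        m' := (tagMatrix k (r :: R)).reverse ++ S.m' }) ?_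
    · refine RunsIn.mono (t := 3 * r.length + (1 + (1 + (1 + (2 * (k + 1) + 1))) +
        ((5 * n + 4) * R.length + 1))) ?_ (by rw [hr, List.length_cons]; linarith)
      simpa using h₁
    · refine RunsIn.loop_step rfl (by simp) (.ite_false (by simp) (.seq (.block rfl) ?_)) ?_
        (s' := mem {} { S with
          inp := R.flatMap fun r => r.map some ++ [none]
          c := List.replicate (k + 1) ()
          c' := []
          m' := none :: ((tagRow k r).map some).reverse ++ S.m' })
      · have h₂ := rewindC_runsIn { S with
          inp := R.flatMap fun r => r.map some ++ [none]
          c := []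
          c' := List.replicate (k + 1) ()
          m' := none :: ((tagRow k r).map some).reverse ++ S.m' }
        simpa using h₂
      · have h₃ := ih (k + 1) (fun r hr => hR r (by simp [hr])) (by omega)
          { S with m' := none :: ((tagRow k r).map some).reverse ++ S.m' }
        rw [show k + 1 + R.length = k + (r :: R).length by rw [List.length_cons]; omega] at h₃
        simpa [tagMatrix, readInput] using h₃

theorem tagRow_eq (k : ℕ) (l : List Bool) :
    tagRow k l = l.mapIdx fun j b => (b, decide (j = k)) := by
  induction l generalizing k with
  | nil => cases k <;> rfl
  | cons b l ih =>
    cases k with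
    | zero => refine List.ext_getElem (by simp [tagRow]) fun i _ _ => ?_; cases i <;> simp [tagRow]
    | succ k => simp [tagRow, List.mapIdx_cons, ih]

theorem tagMatrix_eq (n : ℕ) (A : Fin n → Fin n → Bool) (k : ℕ) :
    tagMatrix k (((List.finRange n).drop k).map fun i => (List.finRange n).map (A i)) =
      matrixList (List.finRange n) (fun i j => (A i j, decide (j = i)))
        ((List.finRange n).drop k) := by
  induction hm : n - k generalizing k with
  | zero => simp [List.drop_of_length_le (show (List.finRange n).length ≤ k by simp; omega),
      tagMatrix, matrixList]
  | succ m ih =>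
    have hk : k < (List.finRange n).length := by simp; omega
    have e := ih (k + 1) (by omega)
    rw [List.drop_eq_getElem_cons hk, List.map_cons, tagMatrix, e, tagRow_eq]
    have : (List.map (A (List.finRange n)[k]) (List.finRange n)).mapIdx
        (fun j b => (b, decide (j = k))) = (List.finRange n).map
          (fun j => (A (List.finRange n)[k] j, decide (j = (List.finRange n)[k]))) :=
      List.ext_getElem (by simp) fun i _ _ => by simp [Fin.ext_iff]
    rw [this]
    simp [matrixList]

/-- The set found by the local search. -/
def searchResult (n : ℕ) (A : Fin n → Fin n → Bool) : Fin n → Bool :=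
  (searchRound (List.finRange n) (fun i j => (A i j, decide (j = i)))
    (List.finRange n))^[n * (n + 1)] fun _ => false

/-- Reading leaves the matrix reversed on `m'`, and copying reverses it back. The counter ends with
`n` units, which become the `n` entries of the empty set; the fuel is the number `n * (n + 1)` of
matrix symbols; the output loop turns the reversed set into vertex order. -/
theorem localSearch_runsIn (n : ℕ) (A : Fin n → Fin n → Bool) :
    RunsIn localSearch
      (mem {} { inp := (List.finRange n).flatMap fun i =>
        ((List.finRange n).map fun j => some (A i j)) ++ [none] })
      ((5 * n + 4) * n + 1 + (2 * (n * (n + 1)) + 1 + (2 * n + 1 +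
        (((9 * (n * (n + 1)) + 5 * n + 6) * n + 2 * (n * (n + 1)) + 4) * (n * (n + 1)) + 1 +
          (2 * (n * (n + 1)) + 1 + (2 * (n * (n + 1)) + 1 + (2 * n + 1)))))))
      (mem {} { out := (List.finRange n).map (searchResult n A) }) := by
  have hM := tagMatrix_eq n A 0
  have h₁ := readInput_runsIn n ((List.finRange n).map fun i => (List.finRange n).map (A i)) 0
    (by simp) (by simp) {}
  rw [List.drop_zero] at hM
  rw [hM] at h₁
  generalize hL : matrixList (List.finRange n) (fun i j => (A i j, decide (j = i)))
    (List.finRange n) = M at *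
  have hl : M.length = n * (n + 1) := by rw [← hL, length_matrixList]; simp
  have h₂ := copyMatrix_runsIn M.reverse { c := List.replicate n () }
  have h₃ := initSet_runsIn n
    { m := M, w := M, fuel := List.replicate (n * (n + 1)) () }
  have h₄ := iterateSearch_runsIn (List.finRange n) (fun i j => (A i j, decide (j = i)))
    (List.finRange n) (fun _ => false) (n * (n + 1)) {}
  rw [hL] at h₄
  have h₅ := clearM_runsIn
    { m := M, w := M, s := (List.finRange n).reverse.map (searchResult n A) }
  have h₆ := clearW_runsIn
    { w := M, s := (List.finRange n).reverse.map (searchResult n A) }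
  have h₇ := outputSet_runsIn { s := (List.finRange n).reverse.map (searchResult n A) }
  refine RunsIn.seq (s' := mem {} { m' := M.reverse, c := List.replicate n () }) ?_ <|
    RunsIn.seq (s' := mem {}
      { m := M, w := M, c := .replicate n (), fuel := .replicate (n * (n + 1)) () }) ?_ <|
    RunsIn.seq (s' := mem {}
      { m := M, w := M, s := .replicate n false, fuel := .replicate (n * (n + 1)) () }) ?_ <|
    RunsIn.seq (s' := mem {}
      { m := M, w := M, s := (List.finRange n).reverse.map (searchResult n A) }) ?_ <|
    RunsIn.seq (s' := mem {}
      { w := M, s := (List.finRange n).reverse.map (searchResult n A) }) ?_ <|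
    RunsIn.seq (s' := mem {}
      { s := (List.finRange n).reverse.map (searchResult n A) }) ?_ ?_
  · simpa [List.flatMap_map, Function.comp_def] using h₁
  · simpa [hl] using h₂
  · simpa using h₃
  · simpa [searchResult] using h₄
  · simpa [hl] using h₅
  · simpa [hl] using h₆
  · simpa using h₇

/-! ### The search runs in polynomial time -/

open Classical in
/-- The vertex set found by the local search. -/
noncomputable def searchSet (G : FinGraph) : Finset (Fin G.1) :=
  Finset.univ.filter fun i => searchResult G.1 (fun i j => decide (G.2.Adj i j)) i

theorem initList_machine (c : Prog) (l : List (Option Bool)) :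
    Turing.initList (c.machine .inp .out {}) l =
      ⟨some (some c.entry), {}, Store.stk { inp := l }⟩ :=
  congrArg (Turing.TM2.Cfg.mk (some (some c.entry)) ({} : Reg)) (by funext k; cases k <;> rfl)

theorem haltList_machine (c : Prog) (l : List Bool) :
    Turing.haltList (c.machine .inp .out {}) l = ⟨none, {}, Store.stk { out := l }⟩ :=
  congrArg (Turing.TM2.Cfg.mk none ({} : Reg)) (by funext k; cases k <;> rfl)

theorem isPolyTime_searchSet : IsPolyTime searchSet := by
  classical
  refine ⟨{
    tm := localSearch.machine .inp .out {}
    inputAlphabet := Equiv.refl _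
    outputAlphabet := Equiv.refl _
    time := 14 * .X ^ 3 + 20 * .X ^ 2 + 40 * .X + 20
    -- The field is data, while the run is only known to exist.
    outputsFun := fun G => Classical.choice ?_ }⟩
  obtain ⟨t, ht, hr⟩ := localSearch_runsIn G.1 (fun i j => decide (G.2.Adj i j))
  refine ⟨{ steps := t + 1, evals_in_steps := ?_, steps_le_m := ?_ }⟩
  · have h := hr.machine_stepsTo .inp .out (v := {})
    have e : encodeVertexSet (searchSet G) =
        (List.finRange G.1).map (searchResult G.1 fun i j => decide (G.2.Adj i j)) := by
      simp [encodeVertexSet, searchSet]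
    have e₁ := (congrArg (Turing.initList (localSearch.machine .inp .out {}))
      (List.map_id (encodeGraph G))).trans (initList_machine localSearch (encodeGraph G))
    have e₂ := (congrArg (Turing.haltList (localSearch.machine .inp .out {}))
      ((List.map_id _).trans e)).trans (haltList_machine localSearch _)
    exact (congrArg (fun x => (flip bind _)^[t + 1] (some x)) e₁).trans
      (Eq.trans h (congrArg some e₂).symm)
  · have hN : (encodeGraph G).length = G.1 * (G.1 + 1) := by
      simp [encodeGraph, List.length_flatMap]
    have hn : G.1 ≤ G.1 * (G.1 + 1) := Nat.le_mul_of_pos_right _ (by omega)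
    rw [hN]
    simp only [Polynomial.eval_add, Polynomial.eval_mul, Polynomial.eval_pow, Polynomial.eval_X,
      Polynomial.eval_ofNat]
    refine (Nat.add_le_add_right ht 1).trans ?_
    generalize hN' : G.1 * (G.1 + 1) = N at *
    -- Every `n` is replaced by the input length `N ≥ n`. The leading term is (9 + 5) N³; the other
    -- coefficients are rounded up.
    calc (5 * G.1 + 4) * G.1 + 1 + (2 * N + 1 + (2 * G.1 + 1 +
          (((9 * N + 5 * G.1 + 6) * G.1 + 2 * N + 4) * N + 1 +
            (2 * N + 1 + (2 * N + 1 + (2 * G.1 + 1)))))) + 1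
        ≤ (5 * N + 4) * N + 1 + (2 * N + 1 + (2 * N + 1 +
          (((9 * N + 5 * N + 6) * N + 2 * N + 4) * N + 1 +
            (2 * N + 1 + (2 * N + 1 + (2 * N + 1)))))) + 1 := by gcongr
      _ ≤ 14 * N ^ 3 + 20 * N ^ 2 + 40 * N + 20 := by ring_nf; omega

end LocalSearchProgram

/-! ### Double counting in claw-free graphs -/

section Counting

variable {V : Type*} {G : SimpleGraph V} {m : ℕ}

theorem ClawFree.card_lt (hG : ClawFree m G) {v : V} {T : Finset V} (hT : G.IsIndepSet (T : Set V))
    (hv : ∀ t ∈ T, G.Adj v t) : T.card < m := by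
  by_contra! h
  obtain ⟨U, hU, hc⟩ := Finset.exists_subset_card_eq h
  let e : Fin m ≃ U := (U.equivFinOfCardEq hc).symm
  have hne : ∀ i, v ≠ e i := fun i => (hv _ (hU (e i).2)).ne
  refine hG ⟨⟨⟨Sum.elim (fun _ => v) (fun i => (e i : V)), ?_⟩, ?_⟩⟩
  · rintro (i | i) (j | j) hij
    · rw [Subsingleton.elim i j]
    · exact absurd hij (hne j)
    · exact absurd hij.symm (hne i)
    · rw [e.injective (Subtype.ext hij)]
  · rintro (i | i) (j | j)
    · change G.Adj v v ↔ _
      simp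
    · change G.Adj v (e j) ↔ _
      simpa using hv _ (hU (e j).2)
    · change G.Adj (e i) v ↔ _
      simpa using (hv _ (hU (e i).2)).symm
    · change G.Adj (e i) (e j) ↔ _
      simpa using fun h : G.Adj (e i) (e j) => hT (hU (e i).2) (hU (e j).2) h.ne h

/-- If `v` is in `T`, only `v` itself counts, and 1 ≤ m - 1. Otherwise the vertices counted are
independent neighbours of `v`, the leaves of a claw. -/
theorem ClawFree.card_filter_le [DecidableEq V] [DecidableRel G.Adj] (hG : ClawFree m G)
    (hm : 2 ≤ m) {T : Finset V} (hT : G.IsIndepSet (T : Set V)) (v : V) :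
    (T.filter fun t => v = t ∨ G.Adj v t).card ≤ m - 1 := by
  by_cases hv : v ∈ T
  · have : (T.filter fun t => v = t ∨ G.Adj v t) ⊆ {v} := by
      intro t ht
      obtain ⟨htT, rfl | h⟩ := Finset.mem_filter.1 ht
      · simp
      · exact absurd h (hT hv htT h.ne)
    have := Finset.card_le_card this
    rw [Finset.card_singleton] at this
    omega
  · refine Nat.le_sub_one_of_lt (hG.card_lt (v := v) (hT.mono fun t ht => ?_) fun t ht => ?_)
    · exact (Finset.mem_filter.1 ht).1
    · obtain ⟨htT, rfl | h⟩ := Finset.mem_filter.1 ht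
      · exact absurd htT hv
      · exact h

theorem sum_card_closedNeighbors [DecidableEq V] [DecidableRel G.Adj] (S T : Finset V) :
    ∑ s ∈ S, (T.filter fun t => s = t ∨ G.Adj s t).card =
      ∑ t ∈ T, (S.filter fun s => t = s ∨ G.Adj t s).card := by
  simp only [Finset.card_filter]
  rw [Finset.sum_comm]
  simp only [eq_comm, G.adj_comm]

theorem IsIndepDominating.one_le_card [DecidableEq V] [DecidableRel G.Adj] {S : Finset V}
    (hS : IsIndepDominating G S) (v : V) : 1 ≤ (S.filter fun s => v = s ∨ G.Adj v s).card := by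
  rw [Nat.one_le_iff_ne_zero, Finset.card_ne_zero]
  rcases hS.2 v with h | ⟨w, hw, h⟩
  · exact ⟨v, by simp [h]⟩
  · exact ⟨w, by simp [hw, h.symm]⟩

theorem ClawFree.card_le_mul_card (hG : ClawFree m G) (hm : 2 ≤ m) {S T : Finset V}
    (hS : G.IsIndepSet (S : Set V)) (hT : IsIndepDominating G T) : S.card ≤ (m - 1) * T.card := by
  classical
  calc S.card = ∑ s ∈ S, 1 := by simp
    _ ≤ ∑ s ∈ S, (T.filter fun t => s = t ∨ G.Adj s t).card :=
      Finset.sum_le_sum fun s _ => hT.one_le_card s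
    _ = ∑ t ∈ T, (S.filter fun s => t = s ∨ G.Adj t s).card := sum_card_closedNeighbors S T
    _ ≤ ∑ t ∈ T, (m - 1) := Finset.sum_le_sum fun t _ => hG.card_filter_le hm hS t
    _ = (m - 1) * T.card := by rw [Finset.sum_const, smul_eq_mul, mul_comm]

/-- No exchange that brings in one vertex or two non-adjacent vertices, and removes their
neighbours, enlarges `S`. -/
def LocallyOptimal [DecidableEq V] (G : SimpleGraph V) [DecidableRel G.Adj] (S : Finset V) : Prop :=
  ∀ i j, ¬ G.Adj i j →
    (({i, j} : Finset V) \ S).card ≤ (S.filter fun k => G.Adj i k ∨ G.Adj j k).card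

/-- The case `i = j = v`: a vertex outside `S` without neighbours in `S` could simply be added. -/
theorem LocallyOptimal.isIndepDominating [DecidableEq V] [DecidableRel G.Adj] {S : Finset V}
    (h : LocallyOptimal G S) (hS : G.IsIndepSet (S : Set V)) : IsIndepDominating G S := by
  refine ⟨hS, fun v => or_iff_not_imp_left.2 fun hv => ?_⟩
  have h₁ := h v v (G.loopless.irrefl v)
  have h₂ : (({v, v} : Finset V) \ S).card = 1 := by
    rw [Finset.pair_eq_singleton, Finset.sdiff_eq_self_of_disjoint (by simpa using hv),
      Finset.card_singleton]
  rw [h₂, Nat.one_le_iff_ne_zero, Finset.card_ne_zero] at h₁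
  obtain ⟨w, hw⟩ := h₁
  simp only [or_self, Finset.mem_filter] at hw
  exact ⟨w, hw.1, hw.2.symm⟩

theorem LocallyOptimal.two_mul_card_le [DecidableEq V] [DecidableRel G.Adj] {S T : Finset V}
    (h : LocallyOptimal G S) (hS : G.IsIndepSet (S : Set V)) (hG : ClawFree m G)
    (hm : 2 ≤ m) (hT : G.IsIndepSet (T : Set V)) : 2 * T.card ≤ m * S.card := by
  have hD := h.isIndepDominating hS
  let N : V → Finset V := fun t => S.filter fun s => t = s ∨ G.Adj t s
  let T₁ := T.filter fun t => (N t).card = 1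
  -- Two vertices of `T₁` with the same partner could both be brought in at the cost of that partner
  -- alone.
  have h₁ : T₁.card ≤ S.card := by
    have hex : ∀ t ∈ T₁, ∃ s, N t = {s} := fun t ht =>
      Finset.card_eq_one.1 (Finset.mem_filter.1 ht).2
    choose! φ hφ using hex
    have hmem : ∀ t ∈ T₁, φ t ∈ S ∧ (t = φ t ∨ G.Adj t (φ t)) := fun t ht =>
      Finset.mem_filter.1 (by rw [hφ t ht]; simp : φ t ∈ N t)
    -- Both vertices must be new for the exchange to gain two. If `t` were in `S`, it would be its
    -- own partner, and then `u` would equal or be adjacent to `t`, against the independence of `T`.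
    have hnot : ∀ t ∈ T₁, ∀ u ∈ T₁, φ t = φ u → t ≠ u → t ∉ S := fun t ht u hu he hne htS => by
      have h₁ : t ∈ N t := Finset.mem_filter.2 ⟨htS, .inl rfl⟩
      rw [hφ t ht, Finset.mem_singleton] at h₁
      have h₂ := (hmem u hu).2
      rw [← he, ← h₁] at h₂
      exact h₂.elim hne.symm fun h₃ =>
        hT (Finset.mem_filter.1 hu).1 (Finset.mem_filter.1 ht).1 hne.symm h₃
    refine Finset.card_le_card_of_injOn φ (fun t ht => (hmem t ht).1) fun t ht u hu he => ?_
    by_contra hne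
    have htS := hnot t ht u hu he hne
    have huS := hnot u hu t ht he.symm (Ne.symm hne)
    have h₁ := h t u (hT (Finset.mem_filter.1 ht).1 (Finset.mem_filter.1 hu).1 hne)
    rw [Finset.sdiff_eq_self_of_disjoint (by simp [htS, huS]), Finset.card_pair hne] at h₁
    have h₂ : (S.filter fun k => G.Adj t k ∨ G.Adj u k) ⊆ {φ t} := by
      intro k hk
      obtain ⟨hkS, hk | hk⟩ := Finset.mem_filter.1 hk
      · rw [← hφ t ht]
        exact Finset.mem_filter.2 ⟨hkS, .inr hk⟩
      · rw [he, ← hφ u hu]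
        exact Finset.mem_filter.2 ⟨hkS, .inr hk⟩
    have h₃ := h₁.trans (Finset.card_le_card h₂)
    simp at h₃
  -- Each `t` has a partner by domination, and those with only one receive an extra unit, at most
  -- |S| units in all.
  have h₂ : ∑ t ∈ T, 2 ≤ ∑ t ∈ T, ((N t).card + if (N t).card = 1 then 1 else 0) := by
    refine Finset.sum_le_sum fun t _ => ?_
    have : 1 ≤ (N t).card := hD.one_le_card t
    split_ifs <;> omega
  have h₃ : ∑ t ∈ T, (N t).card ≤ (m - 1) * S.card := by
    calc ∑ t ∈ T, (N t).card = ∑ s ∈ S, (T.filter fun t => s = t ∨ G.Adj s t).card :=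
          sum_card_closedNeighbors T S
      _ ≤ ∑ s ∈ S, (m - 1) := Finset.sum_le_sum fun s _ => hG.card_filter_le hm hT s
      _ = (m - 1) * S.card := by rw [Finset.sum_const, smul_eq_mul, mul_comm]
  rw [Finset.sum_add_distrib, ← Finset.card_filter, Finset.sum_const, smul_eq_mul] at h₂
  obtain ⟨k, rfl⟩ := Nat.exists_eq_add_of_le' (by omega : 1 ≤ m)
  rw [Nat.add_sub_cancel] at h₃
  change T.card * 2 ≤ _ + T₁.card at h₂
  linarith

end Counting

/-! ### Chess graphs have no large claws -/

section Chess

variable {d : ℕ} {p : ChessPiece d} {P : Finset (Fin d → ℤ)} {x : Fin d → ℤ}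

theorem attacks_of_same_step {v : Fin d → ℤ} (hv : v ∈ p.steps) {k l : ℕ} (hkl : k < l)
    (hl : ∀ j ≤ l, x + j • v ∈ P) : p.Attacks P (x + k • v) (x + l • v) := by
  obtain ⟨i, rfl⟩ := Nat.exists_eq_add_of_le hkl.le
  refine ⟨v, hv, i, by omega, by rw [add_smul, add_assoc], fun j hj => ?_⟩
  rw [add_assoc, ← add_smul]
  exact hl _ (by omega)

theorem attacks_of_opposite_step {v : Fin d → ℤ} (hv : v ∈ p.steps) {k l : ℕ} (hk : 1 ≤ k)
    (hkP : ∀ j ≤ k, x + j • v ∈ P) (hlP : ∀ j ≤ l, x + j • -v ∈ P) :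
    p.Attacks P (x + k • v) (x + l • -v) := by
  refine ⟨-v, p.neg_mem v hv, k + l, by omega, ?_, fun j hj => ?_⟩
  · simp only [add_smul, smul_neg]; abel
  -- Walking back from `x + k v`, the first `k` steps stay on the ray of `v`; the later ones are on
  -- the opposite ray.
  · rcases le_total j k with h | h
    · obtain ⟨i, rfl⟩ := Nat.exists_eq_add_of_le h
      convert hkP i (by omega) using 1
      simp only [add_smul, smul_neg]; abel
    · obtain ⟨i, rfl⟩ := Nat.exists_eq_add_of_le h
      convert hlP i (by omega) using 1
      simp only [add_smul, smul_neg]; abel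

/-- There is one leaf more than there are directions, so two leaves lie in the same direction from
the centre, on one ray or on opposite rays. Either way they attack each other, whereas leaves of a
claw are not adjacent. -/
theorem clawFree_chessGraph (p : ChessPiece d) (P : Finset (Fin d → ℤ)) :
    ClawFree (p.numDirections + 1) (chessGraph p P) := by
  rintro ⟨f⟩
  have hadj : ∀ i, p.Attacks P (f (.inl 0)) (f (.inr i)) := fun i =>
    f.map_rel_iff.2 (by simp)
  choose v hv k hk hy hP using hadj
  obtain ⟨i, -, j, -, hij, he⟩ := Finset.exists_ne_map_eq_of_card_lt_of_maps_to
    (s := (Finset.univ : Finset (Fin (p.numDirections + 1))))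
    (t := p.steps.image fun v => ({v, -v} : Finset (Fin d → ℤ)))
    (by rw [Finset.card_univ, Fintype.card_fin]; exact Nat.lt_succ_self _)
    (f := fun i => {v i, -v i}) (fun i _ => Finset.mem_image_of_mem _ (hv i))
  have hne : (f (.inr i) : Fin d → ℤ) ≠ f (.inr j) := fun h =>
    hij (Sum.inr_injective (f.injective (Subtype.ext h)))
  have hna : ¬ p.Attacks P (f (.inr i)) (f (.inr j)) := fun h => by
    have : (completeBipartiteGraph (Fin 1) (Fin (p.numDirections + 1))).Adj (.inr i) (.inr j) :=
      f.map_rel_iff.1 h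
    simp at this
  have hmem : v j ∈ ({v i, -v i} : Finset (Fin d → ℤ)) := by
    rw [he]
    exact Finset.mem_insert_self _ _
  apply hna
  rw [hy i, hy j] at hne ⊢
  have hPi := hP i
  have hPj := hP j
  rcases Finset.mem_insert.1 hmem with h | h
  · rw [h] at hne hPj ⊢
    rcases lt_trichotomy (k i) (k j) with hlt | heq | hlt
    · exact attacks_of_same_step (hv i) hlt hPj
    · exact absurd (by rw [heq]) hne
    · exact (attacks_of_same_step (hv i) hlt hPi).symm
  · rw [Finset.mem_singleton] at h
    rw [h] at hPj ⊢
    exact attacks_of_opposite_step (hv i) (hk i) hPi hPj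

end Chess

/-! ### The search ends in a locally optimal independent set -/

section LocalSearchCorrect

theorem val_bump (p : Bool) (a : Fin 3) : (bump p a).val = min (a.val + p.toNat) 2 := by
  revert p a
  decide

theorem foldl_stats {α : Type*} (L : List α) (F : α → (Bool × Bool) × (Bool × Bool) × Bool)
    (a : Stats) :
    (L.foldl (fun a x => Stats.add a (F x)) a).1 =
      (a.1 || L.any fun x => (F x).2.1.2 && (F x).1.1) ∧
    (L.foldl (fun a x => Stats.add a (F x)) a).2.1.val =
      min (a.2.1.val + L.countP fun x => (F x).2.2 && ((F x).1.1 || (F x).2.1.1)) 2 ∧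
    (L.foldl (fun a x => Stats.add a (F x)) a).2.2.val =
      min (a.2.2.val + L.countP fun x => !(F x).2.2 && ((F x).1.2 || (F x).2.1.2)) 2 := by
  induction L generalizing a with
  | nil =>
    have h₁ := a.2.1.isLt
    have h₂ := a.2.2.isLt
    simp only [List.foldl_nil, List.any_nil, Bool.or_false, List.countP_nil]
    refine ⟨trivial, ?_, ?_⟩ <;> omega
  | cons x L ih =>
    obtain ⟨h₁, h₂, h₃⟩ := ih (Stats.add a (F x))
    rw [List.foldl_cons, h₁, h₂, h₃, List.countP_cons, List.countP_cons, List.any_cons]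
    simp only [Stats.add, val_bump]
    refine ⟨by rw [Bool.or_assoc], ?_, ?_⟩
    · generalize ((F x).2.2 && ((F x).1.1 || (F x).2.1.1)) = b
      cases b <;> simp <;> omega
    · generalize (!(F x).2.2 && ((F x).1.2 || (F x).2.1.2)) = b
      cases b <;> simp <;> omega

theorem countP_finRange_reverse {n : ℕ} (p : Fin n → Bool) :
    (List.finRange n).reverse.countP p = (Finset.univ.filter fun i => p i = true).card := by
  rw [List.countP_reverse, ← List.toFinset_finRange]
  simpa using (List.Nodup.card_eq_countP (P := fun i => p i = true) (List.nodup_finRange n)).symm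

variable {n : ℕ} (G : SimpleGraph (Fin n)) [DecidableRel G.Adj]

/-- The rows of the adjacency matrix with marked diagonal. -/
def adjRow (i j : Fin n) : Bool × Bool := (decide (G.Adj i j), decide (j = i))

/-- The set given by a characteristic function. -/
def support (h : Fin n → Bool) : Finset (Fin n) := Finset.univ.filter fun i => h i = true

theorem good_pairStats_iff (i j : Fin n) (h : Fin n → Bool) :
    Stats.good (pairStats (List.finRange n).reverse (adjRow G i) (adjRow G j) h) = true ↔
      ¬ G.Adj i j ∧ ((support h).filter fun k => G.Adj i k ∨ G.Adj j k).card <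
        (({i, j} : Finset (Fin n)) \ support h).card := by
  obtain ⟨h₁, h₂, h₃⟩ := foldl_stats (List.finRange n).reverse
    (fun k => (adjRow G i k, adjRow G j k, h k)) (false, 0, 0)
  rw [countP_finRange_reverse] at h₂ h₃
  have e₂ : (Finset.univ.filter fun k => (h k && ((adjRow G i k).1 || (adjRow G j k).1)) = true) =
      (support h).filter fun k => G.Adj i k ∨ G.Adj j k := by
    ext k; simp [support, adjRow]
  have e₃ : (Finset.univ.filter fun k => (!h k && ((adjRow G i k).2 || (adjRow G j k).2)) = true) =
      ({i, j} : Finset (Fin n)) \ support h := by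
    ext k; simp [support, adjRow, and_comm]
  have e₁ : ((List.finRange n).reverse.any fun k => (adjRow G j k).2 && (adjRow G i k).1) =
      decide (G.Adj i j) := by
    rw [Bool.eq_iff_iff]; simp [adjRow]
  -- At most two vertices are won, so cutting off both counts at 2 does not affect whether fewer are
  -- lost than won.
  have hc : (({i, j} : Finset (Fin n)) \ support h).card ≤ 2 :=
    (Finset.card_le_card Finset.sdiff_subset).trans Finset.card_le_two
  simp only [e₁, e₂, e₃] at h₁ h₂ h₃
  unfold Stats.good pairStats
  rw [Bool.and_eq_true, h₁, decide_eq_true_iff, Fin.lt_def, h₂, h₃]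
  simp only [Fin.val_zero, zero_add, Bool.false_or, Bool.not_eq_true', decide_eq_false_iff_not]
  refine and_congr_right fun _ => ?_
  omega

theorem tryRows_of_not_good {i j : Fin n} {h : Fin n → Bool}
    (hg : ¬ Stats.good (pairStats (List.finRange n).reverse (adjRow G i) (adjRow G j) h) = true) :
    tryRows (List.finRange n).reverse (adjRow G i) (adjRow G j) h = h := by
  rw [tryRows, Bool.eq_false_of_not_eq_true hg]
  rfl

theorem support_tryRows_of_good {i j : Fin n} {h : Fin n → Bool}
    (hg : Stats.good (pairStats (List.finRange n).reverse (adjRow G i) (adjRow G j) h) = true) :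
    support (tryRows (List.finRange n).reverse (adjRow G i) (adjRow G j) h) =
      {i, j} ∪ (support h \ (support h).filter fun k => G.Adj i k ∨ G.Adj j k) := by
  rw [tryRows, hg]
  ext k
  simp [support, exchanged, adjRow]
  tauto

theorem card_support_lt_of_good {i j : Fin n} {h : Fin n → Bool}
    (hg : Stats.good (pairStats (List.finRange n).reverse (adjRow G i) (adjRow G j) h) = true) :
    (support h).card <
      (support (tryRows (List.finRange n).reverse (adjRow G i) (adjRow G j) h)).card := by
  rw [support_tryRows_of_good G hg]
  have hlt := ((good_pairStats_iff G i j h).1 hg).2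
  set S := support h
  set C := S.filter fun k => G.Adj i k ∨ G.Adj j k
  have hC : C ⊆ S := Finset.filter_subset _ _
  have h₁ : (S \ C).card + C.card = S.card := Finset.card_sdiff_add_card_eq_card hC
  -- This disjoint union has |{i, j} \ S| + |S| - |C| elements, which exceeds |S| because the
  -- exchange is good.
  have h₂ : (({i, j} : Finset (Fin n)) \ S) ∪ (S \ C) ⊆ {i, j} ∪ (S \ C) :=
    Finset.union_subset_union_left Finset.sdiff_subset
  have h₃ : Disjoint (({i, j} : Finset (Fin n)) \ S) (S \ C) :=
    Finset.sdiff_disjoint.mono_right Finset.sdiff_subset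
  have h₄ := Finset.card_le_card h₂
  rw [Finset.card_union_of_disjoint h₃] at h₄
  omega

theorem tryRows_eq_or_card_lt (i j : Fin n) (h : Fin n → Bool) :
    tryRows (List.finRange n).reverse (adjRow G i) (adjRow G j) h = h ∨
      (support h).card <
        (support (tryRows (List.finRange n).reverse (adjRow G i) (adjRow G j) h)).card := by
  by_cases hg : Stats.good (pairStats (List.finRange n).reverse (adjRow G i) (adjRow G j) h) = true
  · exact .inr (card_support_lt_of_good G hg)
  · exact .inl (tryRows_of_not_good G hg)

theorem isIndepSet_tryRows (i j : Fin n) {h : Fin n → Bool}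
    (hI : G.IsIndepSet (support h : Set (Fin n))) :
    G.IsIndepSet
      (support (tryRows (List.finRange n).reverse (adjRow G i) (adjRow G j) h) : Set (Fin n)) := by
  by_cases hg : Stats.good (pairStats (List.finRange n).reverse (adjRow G i) (adjRow G j) h) = true
  · rw [support_tryRows_of_good G hg]
    have hij := ((good_pairStats_iff G i j h).1 hg).1
    have hji : ¬ G.Adj j i := fun h => hij h.symm
    intro a ha b hb hab hadj
    simp only [Finset.coe_union, Finset.coe_sdiff, Finset.coe_insert, Finset.coe_singleton,
      Finset.coe_filter, Set.mem_union, Set.mem_insert_iff, Set.mem_singleton_iff, Set.mem_sdiff,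
      Set.mem_ofPred_eq, Finset.mem_coe, not_and, not_or] at ha hb
    rcases ha with (rfl | rfl) | ⟨ha, ha'⟩ <;> rcases hb with (rfl | rfl) | ⟨hb, hb'⟩
    all_goals first
      | exact hab rfl
      | exact hij hadj
      | exact hji hadj
      | exact (hb' hb).1 hadj
      | exact (hb' hb).2 hadj
      | exact (ha' ha).1 hadj.symm
      | exact (ha' ha).2 hadj.symm
      | exact hI ha hb hab hadj
  · rwa [tryRows_of_not_good G hg]

/-- No step lowers `μ`, and a step that changes something raises it for good. So a fold that does
not raise `μ` consists of idle steps only. -/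
theorem foldl_eq_or_lt {α β : Type*} (f : β → α → β) (μ : β → ℕ)
    (hf : ∀ x a, f x a = x ∨ μ x < μ (f x a)) (l : List α) (x : β) :
    (l.foldl f x = x ∧ ∀ a ∈ l, f x a = x) ∨ μ x < μ (l.foldl f x) := by
  induction l generalizing x with
  | nil => simp
  | cons a l ih =>
    rw [List.foldl_cons]
    rcases hf x a with h | h
    · rw [h]
      refine (ih x).imp_left fun h' => ⟨h'.1, ?_⟩
      simpa [h] using h'.2
    · rcases ih (f x a) with h' | h'
      · rw [h'.1]
        exact .inr h
      · exact .inr (h.trans h')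

/-- Until a fixed point is reached, each iteration raises `μ` by at least one. -/
theorem iterate_eq_or_lt {β : Type*} (f : β → β) (μ : β → ℕ) (hf : ∀ x, f x = x ∨ μ x < μ (f x))
    (k : ℕ) (x : β) : f (f^[k] x) = f^[k] x ∨ k < μ (f (f^[k] x)) := by
  induction k with
  | zero => exact (hf x).imp_right fun h => (Nat.zero_le _).trans_lt h
  | succ k ih =>
    rw [Function.iterate_succ_apply']
    rcases ih with h | h
    · rw [h]
      exact .inl h
    · exact (hf _).imp_right fun h' => by omega

/-- `foldl_eq_or_lt` applied to the inner and to the outer loop: a round that does not enlarge the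
set has tried every pair on the unchanged set in vain. -/
theorem searchRound_eq_or_card_lt (h : Fin n → Bool) :
    (searchRound (List.finRange n) (adjRow G) (List.finRange n) h = h ∧
      ∀ i j, tryRows (List.finRange n).reverse (adjRow G i) (adjRow G j) h = h) ∨
    (support h).card <
      (support (searchRound (List.finRange n) (adjRow G) (List.finRange n) h)).card := by
  have inner := fun i => foldl_eq_or_lt
    (fun h j => tryRows (List.finRange n).reverse (adjRow G i) (adjRow G j) h)
    (fun h => (support h).card) (fun h j => tryRows_eq_or_card_lt G i j h) (List.finRange n)
  refine (foldl_eq_or_lt (fun h i => (List.finRange n).foldl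
    (fun h j => tryRows (List.finRange n).reverse (adjRow G i) (adjRow G j) h) h)
    (fun h => (support h).card) (fun h i => (inner i h).imp_left And.left)
    (List.finRange n) h).imp_left fun H => ⟨H.1, fun i j => ?_⟩
  rcases inner i h with h' | h'
  · exact h'.2 j (List.mem_finRange j)
  · rw [H.2 i (List.mem_finRange i)] at h'
    exact absurd h' (lt_irrefl _)

theorem foldl_induction {α β : Type*} {f : β → α → β} {p : β → Prop}
    (hf : ∀ x a, p x → p (f x a)) (l : List α) {x : β} (hx : p x) : p (l.foldl f x) := by
  induction l generalizing x with
  | nil => exact hx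
  | cons a l ih => exact ih (hf x a hx)

theorem isIndepSet_searchRound {h : Fin n → Bool} (hI : G.IsIndepSet (support h : Set (Fin n))) :
    G.IsIndepSet (support (searchRound (List.finRange n) (adjRow G) (List.finRange n) h) :
      Set (Fin n)) := by
  unfold searchRound
  refine foldl_induction (p := fun h : Fin n → Bool => G.IsIndepSet (support h : Set (Fin n)))
    (fun _ i hx => ?_) _ hI
  exact foldl_induction (p := fun h : Fin n → Bool => G.IsIndepSet (support h : Set (Fin n)))
    (fun _ j hy => isIndepSet_tryRows G i j hy) _ hx

theorem isIndepSet_searchResult :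
    G.IsIndepSet (support (searchResult n fun i j => decide (G.Adj i j)) : Set (Fin n)) := by
  unfold searchResult
  generalize n * (n + 1) = k
  induction k with
  | zero => simp [support, SimpleGraph.IsIndepSet]
  | succ k ih =>
    rw [Function.iterate_succ_apply']
    exact isIndepSet_searchRound G ih

/-- Any number of rounds from `n` on suffices: a later round that still changed the set would leave
more than `n` vertices in it. At the fixed point a good exchange would enlarge a set that it leaves
unchanged. -/
theorem locallyOptimal_searchResult :
    LocallyOptimal G (support (searchResult n fun i j => decide (G.Adj i j))) := by
  have hfix : ∀ i j, tryRows (List.finRange n).reverse (adjRow G i) (adjRow G j)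
      (searchResult n fun i j => decide (G.Adj i j)) =
      searchResult n fun i j => decide (G.Adj i j) := by
    have H := iterate_eq_or_lt (searchRound (List.finRange n) (adjRow G) (List.finRange n))
      (fun h => (support h).card) (fun h => (searchRound_eq_or_card_lt G h).imp_left And.left)
      (n * (n + 1)) fun _ => false
    rcases H with H | H
    · rcases searchRound_eq_or_card_lt G (searchResult n fun i j => decide (G.Adj i j)) with h | h
      · exact h.2
      · refine absurd h (Eq.not_lt ?_)
        exact congrArg (fun h => (support h).card) H.symm
    · have h₁ : ∀ h : Fin n → Bool, (support h).card ≤ n := fun h => by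
        simpa using Finset.card_le_univ (support h)
      have h₂ : n ≤ n * (n + 1) := Nat.le_mul_of_pos_right n n.succ_pos
      exact absurd (H.trans_le ((h₁ _).trans h₂)) (lt_irrefl _)
  intro i j hij
  by_contra! hlt
  have hg := (good_pairStats_iff G i j _).2 ⟨hij, hlt⟩
  have := card_support_lt_of_good G hg
  rw [hfix] at this
  exact lt_irrefl _ this

end LocalSearchCorrect

/-! ### The approximation factors -/

section Main

/-- Passes from the classical decision procedure in `searchSet` to an arbitrary instance. -/
theorem searchSet_eq (G : FinGraph) [DecidableRel G.2.Adj] :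
    searchSet G = support (searchResult G.1 fun i j => decide (G.2.Adj i j)) := by
  unfold searchSet support
  congr!

theorem isIndepDominating_searchSet (G : FinGraph) : IsIndepDominating G.2 (searchSet G) := by
  classical
  rw [searchSet_eq]
  exact (locallyOptimal_searchResult G.2).isIndepDominating (isIndepSet_searchResult G.2)

theorem maxIndepDom_le {m : ℕ} (hm : 2 ≤ m) (G : FinGraph) (hG : ClawFree m G.2) :
    (maxIndepDom G.2 : ℝ) ≤ (m : ℝ) / 2 * ((searchSet G).card : ℝ) := by
  classical
  -- The supremum is attained: the search supplies one such set, and sizes are at most the number of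
  -- vertices.
  obtain ⟨T, hT, hc⟩ : maxIndepDom G.2 ∈ {k | ∃ S, IsIndepDominating G.2 S ∧ S.card = k} :=
    Nat.sSup_mem ⟨_, _, isIndepDominating_searchSet G, rfl⟩
      ⟨G.1, by rintro _ ⟨S, -, rfl⟩; simpa using Finset.card_le_univ S⟩
  have h : 2 * T.card ≤ m * (searchSet G).card := by
    rw [searchSet_eq]
    exact (locallyOptimal_searchResult G.2).two_mul_card_le (isIndepSet_searchResult G.2) hG hm hT.1
  rw [← hc]
  have h' : (2 : ℝ) * T.card ≤ m * (searchSet G).card := by exact_mod_cast h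
  linarith

theorem card_searchSet_le {m : ℕ} (hm : 2 ≤ m) (G : FinGraph) (hG : ClawFree m G.2) :
    ((searchSet G).card : ℝ) ≤ (m : ℝ) * ((m : ℝ) - 1) / 2 * (minIndepDom G.2 : ℝ) := by
  obtain ⟨T, hT, hc⟩ : minIndepDom G.2 ∈ {k | ∃ S, IsIndepDominating G.2 S ∧ S.card = k} :=
    Nat.sInf_mem ⟨_, _, isIndepDominating_searchSet G, rfl⟩
  have h := hG.card_le_mul_card hm (isIndepDominating_searchSet G).1 hT
  rw [← hc]
  have h' : ((searchSet G).card : ℝ) ≤ ((m : ℝ) - 1) * T.card := by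
    have := (Nat.cast_le (α := ℝ)).2 h
    rwa [Nat.cast_mul, Nat.cast_sub (by omega), Nat.cast_one] at this
  have hm' : (2 : ℝ) ≤ m := by exact_mod_cast hm
  refine h'.trans (mul_le_mul_of_nonneg_right ?_ (Nat.cast_nonneg _))
  -- m - 1 ≤ m(m - 1)/2, that is, (m - 1)(m - 2) ≥ 0.
  nlinarith

theorem maxApproxInPolyTime {m : ℕ} (hm : 2 ≤ m) {C : FinGraph → Prop}
    (hC : ∀ G, C G → ClawFree m G.2) : MaxApproxInPolyTime C ((m : ℝ) / 2) :=
  ⟨searchSet, isPolyTime_searchSet, fun G hG =>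
    ⟨isIndepDominating_searchSet G, maxIndepDom_le hm G (hC G hG)⟩⟩

theorem minBoundInPolyTime {m : ℕ} (hm : 2 ≤ m) {C : FinGraph → Prop}
    (hC : ∀ G, C G → ClawFree m G.2) : MinBoundInPolyTime C ((m : ℝ) * ((m : ℝ) - 1) / 2) :=
  ⟨searchSet, isPolyTime_searchSet, fun G hG =>
    ⟨isIndepDominating_searchSet G, card_searchSet_le hm G (hC G hG)⟩⟩

theorem IsChessGraph.clawFree {d : ℕ} {p : ChessPiece d} {G : FinGraph} (hG : IsChessGraph p G) :
    ClawFree (p.numDirections + 1) G.2 := by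
  obtain ⟨P, -, ⟨e⟩⟩ := hG
  rintro ⟨f⟩
  exact clawFree_chessGraph p P ⟨e.toEmbedding.comp f⟩

end Main

end ClawFreeDomination

open ClawFreeDomination in
theorem mainTheorem8 :
    (∀ m : ℕ, 2 ≤ m →
      MaxApproxInPolyTime (fun G => ClawFree m G.2) ((m : ℝ) / 2) ∧
      MinBoundInPolyTime (fun G => ClawFree m G.2) ((m : ℝ) * ((m : ℝ) - 1) / 2)) ∧
    (∀ d : ℕ, 2 ≤ d → ∀ (p : ChessPiece d) (m : ℕ), p.numDirections + 1 = m → 2 ≤ m →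
      (∀ P : Finset (Fin d → ℤ), IsPolycube P → ClawFree m (chessGraph p P)) ∧
      MaxApproxInPolyTime (IsChessGraph p) ((m : ℝ) / 2) ∧
      MinBoundInPolyTime (IsChessGraph p) ((m : ℝ) * ((m : ℝ) - 1) / 2)) := by
  refine ⟨fun m hm => ⟨maxApproxInPolyTime hm fun _ h => h, minBoundInPolyTime hm fun _ h => h⟩, ?_⟩
  rintro d - p m rfl hm
  exact ⟨fun P _ => clawFree_chessGraph p P, maxApproxInPolyTime hm fun _ h => h.clawFree,
    minBoundInPolyTime hm fun _ h => h.clawFree⟩
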